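/- Let $L$ be an oriented link and let $p$ be a prime or $0$. For a field $\mathbb F$ of characteristic $p$ and an oriented diagram $D$ of $L$ in the plane, with $n_+$ positive and $n_-$ negative crossings, let $C_{\mathrm{BN}}(D;\mathbb F)$ be the Bar-Natan complex, i.e. the Khovanov cube-of-smoothings complex for the Frobenius algebra $A=\mathbb F[X]/(X^2-X)$ with $\Delta(1)=X\otimes 1+1\otimes X-1\otimes 1$, $\varepsilon(1)=0$, $\varepsilon(X)=1$. A smoothing with $r$ $1$-smoothings contributes $A^{\otimes\#\text{circles}}$ in homological degree $r-n_-$; the $q$-degree is determined by $|1|_q=1$, $|X|_q=-1$ on $A$ and a shift by $r+n_+-2n_-$. The subcomplexes $\mathscr F_j$ spanned by the generators of $q$-degree at least $j$, with $j\in|L|+2\mathbb Z$, where $|L|$ is the number of components of $L$, form a finite filtration $\cdots\subset\mathscr F_{j+2}\subset\mathscr F_j\subset\cdots$ of $C_{\mathrm{BN}}(D;\mathbb F)$; let $(E_r^{i,j})$ be the spectral sequence of this filtration (the Bar-Natan--Lee--Turner spectral sequence), where $i$ is the homological degree. Put $$s^p_{\min}(L)=\min\{j\in |L|+2\mathbb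 Z\mid E_\infty^{0,j}\neq 0\}+1 .$$ Let $\mathfrak s_{\mathcal O}\in H^0_{\mathrm{BN}}(L;\mathbb F)$ be the canonical class of the orientation $\mathcal O$ of $L$: color the regions of the plane in checkerboard fashion with the unbounded region white; the class is represented, in the summand of the oriented smoothing of $D$, by $\bigotimes_C I_C$ over the circles $C$ of that smoothing, where $I_C=X$ if the white region is to the right of $C$ and $I_C=1-X$ if it is to the left. Put $$s^p(L)=\max\{j\in|L|+2\mathbb Z\mid \mathfrak s_{\mathcal O}\in\operatorname{im}(H(\mathscr F_j)\to H_{\mathrm{BN}}(L;\mathbb F))\}+1 .$$ Then there is an orientation on the underlying unoriented link of $L$ such that the resulting oriented link $\tilde L$ satisfies $s^p(\tilde L)=s^p_{\min}(L)$, where the common value and the orientation do not depend on the choice of the field $\mathbb F$ of characteristic $p$. Moreover, $\tilde L$ and $L$ have the same total linking number (the sum of the linking numbers of all pairs of distinct components). -/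

import Mathlib

/-- The shape of the nontrivial part of a horizontal slice of a link diagram: a local minimum, a
local maximum, or a crossing.  In `cross b` the strand from bottom left to top right is the
over-strand if and only if `b = true`. -/
inductive SliceKind where
  | cup
  | cap
  | cross (b : Bool)

namespace SliceKind

def isCross : SliceKind → Bool
  | cross _ => true
  | _ => false

def blOver : SliceKind → Bool
  | cross b => b
  | _ => false

/-- `κ.Fits i w w'`: a slice of kind `κ` whose nontrivial part has exactly `i` vertical strands to
its left can have `w` endpoints at its bottom and `w'` endpoints at its top. -/
def Fits : SliceKind → ℕ → ℕ → ℕ → Prop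
  | cup, i, w, w' => i ≤ w ∧ w' = w + 2
  | cap, i, w, w' => i + 2 ≤ w ∧ w = w' + 2
  | cross _, i, w, w' => i + 2 ≤ w ∧ w' = w

end SliceKind

/-- An (unoriented) link diagram in the plane, in general position with respect to the height
function and cut by horizontal lines into slices, listed from bottom to top, each of which consists
of vertical strands and exactly one local minimum, local maximum or crossing. Every link diagram in
the plane is of this form after a planar isotopy. Horizontal line number `k` (for
`k = 0, …, numSlices`) meets the diagram in `width k` points, numbered `0, 1, …` from left to right;
slice number `k` lies between the lines `k` and `k + 1`. -/
structure LinkDiagram where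
  numSlices : ℕ
  kind : Fin numSlices → SliceKind
  pos : Fin numSlices → ℕ
  width : Fin (numSlices + 1) → ℕ
  width_zero : width 0 = 0
  width_last : width (Fin.last numSlices) = 0
  fits : ∀ k, (kind k).Fits (pos k) (width k.castSucc) (width k.succ)

/-- The ways to join the four endpoints of a crossing: straight through the crossing, or by one of
the two smoothings `)(` (vertical) and `≍` (horizontal). -/
inductive CrossingMode where
  | through
  | vertical
  | horizontal

namespace LinkDiagram

/-- The points in which the diagram meets the horizontal lines. -/
abbrev Point (D : LinkDiagram) : Type := (k : Fin (D.numSlices + 1)) × Fin (D.width k)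

abbrev Crossing (D : LinkDiagram) : Type := {k : Fin D.numSlices // (D.kind k).isCross = true}

variable (D : LinkDiagram)

/-- `p` is the `j`-th point on the `k`-th horizontal line. -/
def At (p : D.Point) (k j : ℕ) : Prop := (p.1 : ℕ) = k ∧ (p.2 : ℕ) = j

/-- `D.Arc m p q`: some slice contains an arc from `p` to `q`, when the crossings are treated as
prescribed by `m`. -/
inductive Arc (m : D.Crossing → CrossingMode) : D.Point → D.Point → Prop
  | left (k : Fin D.numSlices) (j : ℕ) (p q : D.Point) :
      j < D.pos k → D.At p k j → D.At q (k + 1) j → Arc m p q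
  | right_of_cup (k : Fin D.numSlices) (j : ℕ) (p q : D.Point) :
      D.kind k = SliceKind.cup → D.pos k ≤ j → D.At p k j → D.At q (k + 1) (j + 2) → Arc m p q
  | right_of_cap (k : Fin D.numSlices) (j : ℕ) (p q : D.Point) :
      D.kind k = SliceKind.cap → D.pos k ≤ j → D.At p k (j + 2) → D.At q (k + 1) j → Arc m p q
  | right_of_cross (c : D.Crossing) (j : ℕ) (p q : D.Point) :
      D.pos c.1 + 2 ≤ j → D.At p c.1 j → D.At q (c.1 + 1) j → Arc m p q
  | cup (k : Fin D.numSlices) (p q : D.Point) : D.kind k = SliceKind.cup →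
      D.At p (k + 1) (D.pos k) → D.At q (k + 1) (D.pos k + 1) → Arc m p q
  | cap (k : Fin D.numSlices) (p q : D.Point) : D.kind k = SliceKind.cap →
      D.At p k (D.pos k) → D.At q k (D.pos k + 1) → Arc m p q
  | through₁ (c : D.Crossing) (p q : D.Point) : m c = CrossingMode.through →
      D.At p c.1 (D.pos c.1) → D.At q (c.1 + 1) (D.pos c.1 + 1) → Arc m p q
  | through₂ (c : D.Crossing) (p q : D.Point) : m c = CrossingMode.through →
      D.At p c.1 (D.pos c.1 + 1) → D.At q (c.1 + 1) (D.pos c.1) → Arc m p q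
  | vertical₁ (c : D.Crossing) (p q : D.Point) : m c = CrossingMode.vertical →
      D.At p c.1 (D.pos c.1) → D.At q (c.1 + 1) (D.pos c.1) → Arc m p q
  | vertical₂ (c : D.Crossing) (p q : D.Point) : m c = CrossingMode.vertical →
      D.At p c.1 (D.pos c.1 + 1) → D.At q (c.1 + 1) (D.pos c.1 + 1) → Arc m p q
  | horizontal₁ (c : D.Crossing) (p q : D.Point) : m c = CrossingMode.horizontal →
      D.At p c.1 (D.pos c.1) → D.At q c.1 (D.pos c.1 + 1) → Arc m p q
  | horizontal₂ (c : D.Crossing) (p q : D.Point) : m c = CrossingMode.horizontal →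
      D.At p (c.1 + 1) (D.pos c.1) → D.At q (c.1 + 1) (D.pos c.1 + 1) → Arc m p q

/-- Two points are equivalent if they lie on the same closed curve. -/
def curveSetoid (m : D.Crossing → CrossingMode) : Setoid D.Point := Relation.EqvGen.setoid (D.Arc m)

/-- The closed curves that arise when the crossings are treated as prescribed by `m`. -/
abbrev Curve (m : D.Crossing → CrossingMode) : Type := Quotient (D.curveSetoid m)

/-- The components of the link. -/
abbrev Component : Type := D.Curve (fun _ => CrossingMode.through)

noncomputable def numComponents : ℕ := Nat.card D.Component

variable {D}

/-- The bottom left endpoint of a crossing. -/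
def bl (c : D.Crossing) : D.Point := ⟨c.1.castSucc, ⟨D.pos c.1, by
  obtain ⟨k, hk⟩ := c
  have h := D.fits k
  cases hx : D.kind k <;> rw [hx] at h hk <;> simp [SliceKind.isCross, SliceKind.Fits] at h hk ⊢
  omega⟩⟩

/-- The bottom right endpoint of a crossing. -/
def br (c : D.Crossing) : D.Point := ⟨c.1.castSucc, ⟨D.pos c.1 + 1, by
  obtain ⟨k, hk⟩ := c
  have h := D.fits k
  cases hx : D.kind k <;> rw [hx] at h hk <;> simp [SliceKind.isCross, SliceKind.Fits] at h hk ⊢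
  omega⟩⟩

/-- The top right endpoint of a crossing. -/
def tr (c : D.Crossing) : D.Point := ⟨c.1.succ, ⟨D.pos c.1 + 1, by
  obtain ⟨k, hk⟩ := c
  have h := D.fits k
  cases hx : D.kind k <;> rw [hx] at h hk <;> simp [SliceKind.isCross, SliceKind.Fits] at h hk ⊢
  omega⟩⟩

variable (D)

/-- An orientation of the link, given by the vertical direction (`true` for upwards) in which each
point is passed: it is kept along arcs between different lines, and it changes along the arc of a
local maximum or minimum. -/
structure Orientation where
  up : D.Point → Bool
  compat : ∀ p q, D.Arc (fun _ => CrossingMode.through) p q → (up p = up q ↔ p.1 ≠ q.1)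

variable {D}

/-- A crossing is positive if turning the over-strand counterclockwise through the angle smaller
than `π` moves its direction to that of the under-strand. -/
def IsPositive (o : D.Orientation) (c : D.Crossing) : Bool :=
  (D.kind c.1).blOver == (o.up (bl c) == o.up (br c))

def nPlus (o : D.Orientation) : ℕ :=
  (Finset.univ.filter fun c : D.Crossing => IsPositive o c = true).card

def nMinus (o : D.Orientation) : ℕ :=
  (Finset.univ.filter fun c : D.Crossing => IsPositive o c = false).card

open Classical in
/-- The sum of the linking numbers of all unordered pairs of distinct components, i.e. half the
number of crossings between distinct components, counted with sign. -/
noncomputable def totalLinkingNumber (o : D.Orientation) : ℚ :=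
  (∑ c : D.Crossing,
    if (⟦bl c⟧ : D.Component) = ⟦br c⟧ then 0 else if IsPositive o c = true then 1 else -1) / 2

variable (D)

/-- A choice of a `0`-smoothing (`false`) or a `1`-smoothing (`true`) at each crossing. -/
abbrev State : Type := D.Crossing → Bool

variable {D}

/-- Turning the over-strand counterclockwise sweeps the two regions that are joined in the
`0`-smoothing. -/
def smoothing (v : D.State) (c : D.Crossing) : CrossingMode :=
  if (D.kind c.1).blOver = v c then CrossingMode.horizontal else CrossingMode.vertical

abbrev Circle (v : D.State) : Type := D.Curve (smoothing v)

variable (D)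

/-- A basis of `⨁_v A^{⊗ circles of v}`, where `A = F[X]/(X² - X)` has the basis `1, X`: a state
together with a label `1` (`false`) or `X` (`true`) on each of its circles. -/
abbrev EnhancedState : Type := (v : D.State) × (Circle v → Bool)

noncomputable instance instFintypeEnhancedState : Fintype D.EnhancedState := by
  classical
  haveI (v : D.State) : Finite (Circle v) := Quotient.finite _
  haveI (v : D.State) : Fintype (Circle v) := Fintype.ofFinite _
  exact inferInstance

variable {D}

/-- The coefficient of the basis element `z` in the product `x y` in `F[X]/(X² - X)`. -/
def mulCoeff (x y z : Bool) : ℤ := if z = (x || y) then 1 else 0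

/-- The coefficient of `y ⊗ z` in `Δ x`, where
`Δ 1 = X ⊗ 1 + 1 ⊗ X - 1 ⊗ 1` and `Δ X = X ⊗ X`. -/
def comulCoeff (x y z : Bool) : ℤ :=
  match x, y, z with
  | false, true, false => 1
  | false, false, true => 1
  | false, false, false => -1
  | true, true, true => 1
  | _, _, _ => 0

open Classical in
/-- The matrix coefficient from `s` to `t` of the map induced by the saddle at `c`. The two arcs of
either smoothing of `c` contain `bl c` and `tr c`, respectively; hence the saddle merges two circles
if these points lie on distinct circles before the saddle, and it splits a circle if they lie on
distinct circles only afterwards. -/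
noncomputable def saddleCoeff (c : D.Crossing) (s t : D.EnhancedState) : ℤ :=
  if ∀ p : D.Point, (⟦p⟧ : Circle s.1) ≠ ⟦bl c⟧ → (⟦p⟧ : Circle s.1) ≠ ⟦tr c⟧ →
      s.2 ⟦p⟧ = t.2 ⟦p⟧ then
    if (⟦bl c⟧ : Circle s.1) ≠ ⟦tr c⟧ then mulCoeff (s.2 ⟦bl c⟧) (s.2 ⟦tr c⟧) (t.2 ⟦bl c⟧)
    else if (⟦bl c⟧ : Circle t.1) ≠ ⟦tr c⟧ then
      comulCoeff (s.2 ⟦bl c⟧) (t.2 ⟦bl c⟧) (t.2 ⟦tr c⟧)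
    else 0
  else 0

open Classical in
/-- The matrix coefficient from `s` to `t` of the differential of the cube of smoothings. -/
noncomputable def dCoeff (s t : D.EnhancedState) : ℤ :=
  ∑ c : D.Crossing,
    if s.1 c = false ∧ t.1 = Function.update s.1 c true then
      (-1) ^ (Finset.univ.filter fun c' : D.Crossing => c' < c ∧ s.1 c' = true).card *
        saddleCoeff c s t
    else 0

section BarNatan

variable (F : Type*) [Field F]

variable (D) in
/-- The sum of all cochain groups of the Bar-Natan complex of `D`. -/
abbrev Cochain : Type _ := D.EnhancedState → F

/-- The differential of the Bar-Natan complex. -/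
noncomputable def d : D.Cochain F →ₗ[F] D.Cochain F where
  toFun x t := ∑ s, (dCoeff s t : F) * x s
  map_add' x y := by
    funext t
    simp [mul_add, Finset.sum_add_distrib]
  map_smul' a x := by
    funext t
    simp only [Pi.smul_apply, smul_eq_mul, RingHom.id_apply, Finset.mul_sum]
    exact Finset.sum_congr rfl fun s _ => by ring

/-- The number of `1`-smoothings. -/
def weight (v : D.State) : ℕ := (Finset.univ.filter fun c => v c = true).card

/-- The homological degree. -/
def homDegree (o : D.Orientation) (s : D.EnhancedState) : ℤ := weight s.1 - nMinus o

/-- The `q`-degree, where `|1|_q = 1` and `|X|_q = -1`. -/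
noncomputable def qDegree (o : D.Orientation) (s : D.EnhancedState) : ℤ :=
  (∑ᶠ C : Circle s.1, if s.2 C = true then -1 else 1) + weight s.1 + nPlus o - 2 * nMinus o

/-- The cochains of homological degree `i`. -/
def homPart (o : D.Orientation) (i : ℤ) : Submodule F (D.Cochain F) where
  carrier := {x | ∀ s, x s ≠ 0 → homDegree o s = i}
  add_mem' {x y} hx hy s hs := by
    by_cases h : x s = 0
    · exact hy s fun h' => hs (by simp [h, h'])
    · exact hx s h
  zero_mem' s hs := absurd rfl hs
  smul_mem' a x hx s hs := hx s fun h => hs (by simp [h])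

/-- The filtration `𝓕_j`: the cochains that are combinations of generators of `q`-degree at
least `j`. -/
def filtration (o : D.Orientation) (j : ℤ) : Submodule F (D.Cochain F) where
  carrier := {x | ∀ s, x s ≠ 0 → j ≤ qDegree o s}
  add_mem' {x y} hx hy s hs := by
    by_cases h : x s = 0
    · exact hy s fun h' => hs (by simp [h, h'])
    · exact hx s h
  zero_mem' s hs := absurd rfl hs
  smul_mem' a x hx s hs := hx s fun h => hs (by simp [h])

/-! ### Bar-Natan homology and the `s`-invariant -/

variable (D) in
/-- Cochains modulo coboundaries. Homology is the subspace of the classes of cocycles. -/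
abbrev CochainClass : Type _ := D.Cochain F ⧸ LinearMap.range (d F : D.Cochain F →ₗ[F] D.Cochain F)

/-- `im (H(𝓕_j) → H)`: the classes of the cocycles in `𝓕_j`. -/
noncomputable def homologyFiltration (o : D.Orientation) (j : ℤ) : Submodule F (D.CochainClass F) :=
  (LinearMap.ker (d F) ⊓ filtration F o j).map (Submodule.mkQ _)

/-- The smoothing of the diagram that preserves the orientation: `)(` if both strands pass the
crossing upwards or both pass it downwards, and `≍` otherwise. -/
def orientedState (o : D.Orientation) : D.State := fun c =>
  (D.kind c.1).blOver != (o.up (bl c) == o.up (br c))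

/-- Color the regions of the plane such that the region between the points `j - 1` and `j` of a
horizontal line is white if and only if `j` is even; in particular, the unbounded region is white.
Then `whiteOnRight o p` says whether the region to the right of the oriented curve through `p` is
white. -/
def whiteOnRight (o : D.Orientation) (p : D.Point) : Bool :=
  if o.up p = true then decide (Even ((p.2 : ℕ) + 1)) else decide (Even (p.2 : ℕ))

theorem at_unique {p q : D.Point} {k j : ℕ} (hp : D.At p k j) (hq : D.At q k j) : p = q := by
  obtain ⟨p1, p2⟩ := p
  obtain ⟨q1, q2⟩ := q
  obtain ⟨h1, h2⟩ := hp
  obtain ⟨h3, h4⟩ := hq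
  obtain rfl : p1 = q1 := Fin.ext (h1.trans h3.symm)
  obtain rfl : p2 = q2 := Fin.ext (h2.trans h4.symm)
  rfl


theorem whiteOnRight_eq_of_through (o : D.Orientation) {p q : D.Point}
    (h : D.Arc (fun _ => CrossingMode.through) p q)
    (hpq : (p.1 ≠ q.1 ∧ Even ((p.2 : ℕ) + q.2)) ∨ (p.1 = q.1 ∧ ¬ Even ((p.2 : ℕ) + q.2))) :
    whiteOnRight o p = whiteOnRight o q := by
  have hc := o.compat p q h
  unfold whiteOnRight
  rcases hpq with ⟨h1, h2⟩ | ⟨h1, h2⟩ <;> cases hp : o.up p <;> cases hq : o.up q <;>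
    simp_all [Nat.even_add, Nat.even_add_one] <;> rw [← Nat.not_even_iff_odd] <;> tauto

theorem up_bl_eq (o : D.Orientation) (c : D.Crossing) {q : D.Point}
    (hq : D.At q (c.1 + 1) (D.pos c.1 + 1)) : o.up (bl c) = o.up q := by
  refine (o.compat _ _ (Arc.through₁ c _ _ rfl ⟨rfl, rfl⟩ hq)).2 fun h => ?_
  have h' := congrArg Fin.val h
  simp [bl, hq.1] at h'

theorem up_br_eq (o : D.Orientation) (c : D.Crossing) {q : D.Point}
    (hq : D.At q (c.1 + 1) (D.pos c.1)) : o.up (br c) = o.up q := by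
  refine (o.compat _ _ (Arc.through₂ c _ _ rfl ⟨rfl, rfl⟩ hq)).2 fun h => ?_
  have h' := congrArg Fin.val h
  simp [br, hq.1] at h'

theorem smoothing_orientedState (o : D.Orientation) (c : D.Crossing) :
    smoothing (orientedState o) c =
      if o.up (bl c) = o.up (br c) then CrossingMode.vertical else CrossingMode.horizontal := by
  unfold smoothing orientedState
  cases (D.kind c.1).blOver <;> cases o.up (bl c) <;> cases o.up (br c) <;> rfl

theorem whiteOnRight_eq_of_arc (o : D.Orientation) {p q : D.Point}
    (h : D.Arc (smoothing (orientedState o)) p q) : whiteOnRight o p = whiteOnRight o q := by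
  have ne {p q : D.Point} {k : ℕ} (h1 : (p.1 : ℕ) = k) (h2 : (q.1 : ℕ) = k + 1) : p.1 ≠ q.1 :=
    fun h => by have := congrArg Fin.val h; omega
  cases h with
  | left k j p q hj hp hq =>
    exact whiteOnRight_eq_of_through o (.left k j p q hj hp hq)
      (.inl ⟨ne hp.1 hq.1, by rw [hp.2, hq.2]; exact ⟨j, rfl⟩⟩)
  | right_of_cup k j p q hk hj hp hq =>
    exact whiteOnRight_eq_of_through o (.right_of_cup k j p q hk hj hp hq)
      (.inl ⟨ne hp.1 hq.1, by rw [hp.2, hq.2]; exact ⟨j + 1, by ring⟩⟩)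
  | right_of_cap k j p q hk hj hp hq =>
    exact whiteOnRight_eq_of_through o (.right_of_cap k j p q hk hj hp hq)
      (.inl ⟨ne hp.1 hq.1, by rw [hp.2, hq.2]; exact ⟨j + 1, by ring⟩⟩)
  | right_of_cross c j p q hj hp hq =>
    exact whiteOnRight_eq_of_through o (.right_of_cross c j p q hj hp hq)
      (.inl ⟨ne hp.1 hq.1, by rw [hp.2, hq.2]; exact ⟨j, rfl⟩⟩)
  | cup k p q hk hp hq =>
    exact whiteOnRight_eq_of_through o (.cup k p q hk hp hq)
      (.inr ⟨Fin.ext (hp.1.trans hq.1.symm), by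
        rw [hp.2, hq.2]; simp [Nat.even_add_one, ← add_assoc]⟩)
  | cap k p q hk hp hq =>
    exact whiteOnRight_eq_of_through o (.cap k p q hk hp hq)
      (.inr ⟨Fin.ext (hp.1.trans hq.1.symm), by
        rw [hp.2, hq.2]; simp [Nat.even_add_one, ← add_assoc]⟩)
  | through₁ c p q hm => rw [smoothing_orientedState] at hm; split_ifs at hm
  | through₂ c p q hm => rw [smoothing_orientedState] at hm; split_ifs at hm
  | vertical₁ c p q hm hp hq =>
    rw [smoothing_orientedState] at hm
    split_ifs at hm with hu
    have h1 := up_br_eq o c hq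
    obtain rfl : p = bl c := at_unique hp ⟨rfl, rfl⟩
    simp [whiteOnRight, hp.2, hq.2, ← h1, hu]
  | vertical₂ c p q hm hp hq =>
    rw [smoothing_orientedState] at hm
    split_ifs at hm with hu
    have h1 := up_bl_eq o c hq
    obtain rfl : p = br c := at_unique hp ⟨rfl, rfl⟩
    simp [whiteOnRight, hp.2, hq.2, ← h1, hu]
  | horizontal₁ c p q hm hp hq =>
    rw [smoothing_orientedState] at hm
    split_ifs at hm with hu
    obtain rfl : p = bl c := at_unique hp ⟨rfl, rfl⟩
    obtain rfl : q = br c := at_unique hq ⟨rfl, rfl⟩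
    unfold whiteOnRight
    rw [hp.2, hq.2]
    cases h1 : o.up (bl c) <;> cases h2 : o.up (br c) <;> simp_all [Nat.even_add_one]
  | horizontal₂ c p q hm hp hq =>
    rw [smoothing_orientedState] at hm
    split_ifs at hm with hu
    have h1 := up_br_eq o c hp
    have h2 := up_bl_eq o c hq
    unfold whiteOnRight
    rw [hp.2, hq.2, ← h1, ← h2]
    cases h1 : o.up (bl c) <;> cases h2 : o.up (br c) <;> simp_all [Nat.even_add_one]

/-- Whether the region to the right of a circle of the oriented smoothing is white. -/
def circleWhiteOnRight (o : D.Orientation) (v : D.State) (hv : v = orientedState o) :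
    Circle v → Bool :=
  Quotient.lift (whiteOnRight o) fun p q h => by
    subst hv
    induction h with
    | rel _ _ h => exact whiteOnRight_eq_of_arc o h
    | refl _ => rfl
    | symm _ _ _ ih => exact ih.symm
    | trans _ _ _ _ _ ih₁ ih₂ => exact ih₁.trans ih₂

/-- The coefficient of the basis element `x` of `F[X]/(X² - X)` in `X` (if `w = true`) or in
`1 - X` (if `w = false`). -/
def idempotentCoeff (w x : Bool) : ℤ :=
  if x = true then (if w = true then 1 else -1) else (if w = true then 0 else 1)

open Classical in
/-- The canonical cocycle `𝔰_o`: in the summand of the oriented smoothing, it is the tensor product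
over all circles `C` of the elements `I_C`, where `I_C = X` if the white region is to the right of
`C`, and `I_C = 1 - X` if it is to the left. -/
noncomputable def canonicalCocycle (o : D.Orientation) : D.Cochain F := fun s =>
  if h : s.1 = orientedState o then
    ∏ᶠ C : Circle s.1, (idempotentCoeff (circleWhiteOnRight o s.1 h C) (s.2 C) : F)
  else 0

/-- `t` is the `s`-invariant of the oriented link, computed over the field `F`:
`t - 1` is the `q`-grading of the class of the canonical cocycle, i.e. the maximum of all
`j ∈ |L| + 2ℤ` such that the class lies in the `j`-th step of the filtration of homology. -/
def IsSInvariant (o : D.Orientation) (t : ℤ) : Prop :=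
  IsGreatest {j : ℤ | j ≡ D.numComponents [ZMOD 2] ∧
    Submodule.Quotient.mk (canonicalCocycle F o) ∈ homologyFiltration F o j} (t - 1)

/-! ### The spectral sequence -/

/-- `Z_r^{i,j}`: the cochains in `𝓕_j` of homological degree `i` whose coboundary lies
in `𝓕_{j+2r}`. -/
noncomputable def pageCycles (o : D.Orientation) (r i j : ℤ) : Submodule F (D.Cochain F) :=
  homPart F o i ⊓ filtration F o j ⊓ (filtration F o (j + 2 * r)).comap (d F)

/-- `Z_{r-1}^{i,j+2} + d Z_{r-1}^{i-1,j-2(r-1)}`. -/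
noncomputable def pageBoundaries (o : D.Orientation) (r i j : ℤ) : Submodule F (D.Cochain F) :=
  pageCycles F o (r - 1) i (j + 2) ⊔ (pageCycles F o (r - 1) (i - 1) (j - 2 * (r - 1))).map (d F)

/-- The term `E_r^{i,j}`, for `j ∈ |L| + 2ℤ`, of the spectral sequence of the filtered Bar-Natan
complex `⋯ ⊆ 𝓕_{j+2} ⊆ 𝓕_j ⊆ 𝓕_{j-2} ⊆ ⋯`. -/
abbrev Page (o : D.Orientation) (r i j : ℤ) : Type _ :=
  pageCycles F o r i j ⧸ (pageBoundaries F o r i j).comap (pageCycles F o r i j).subtype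

/-- `E_∞^{i,j} ≠ 0`. The filtration is finite, so for fixed `i` and `j` all terms `E_r^{i,j}` with
`r` sufficiently large agree, and they are `E_∞^{i,j}`. -/
def EInftyNeZero (o : D.Orientation) (i j : ℤ) : Prop :=
  ∀ᶠ r : ℤ in Filter.atTop, Nontrivial (Page F o r i j)

/-- `t = s_min`, computed over the field `F`: `t - 1` is the minimum of all `j` with
`E_∞^{0,j} ≠ 0`. -/
def IsSMin (o : D.Orientation) (t : ℤ) : Prop :=
  IsLeast {j : ℤ | j ≡ D.numComponents [ZMOD 2] ∧ EInftyNeZero F o 0 j} (t - 1)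

end BarNatan

end LinkDiagram

/-! Over any field, `A` is spanned by the orthogonal idempotents `X` and `1 - X`. Write the cube
complex in the resulting basis: a state together with an idempotent on each circle, encoded as a
`Bool`-labelling `f` of the points that is constant on circles. Since `1 = X + (1 - X)`, a standard
generator has coordinate 1 at `f` if its `X`-labels sit where `f` is `true` (`Dominated`), and 0
otherwise; this gives the functional `evalAt`. Saddles are diagonal in this basis
(`sum_saddleCoeff`), so the complex splits over `f` into signed cubes (`evalAt_d`).

If `f` takes equal values on the two arcs at some crossing, its cube has an edge direction along
which it contracts (`exists_evalAt_d_eq`). Otherwise its cube is a single vertex on which the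
differential vanishes, and `f` is the colouring of an orientation (`exists_orientation`). Hence
homology has the canonical classes as a basis; what the proof needs is that they span
(`exists_eq_d_add_sum_canonicalCocycle`) and are nonzero (`canonicalCocycle_ne_d`). The topological
input is that a saddle always merges two circles or splits one (`Adjacent.rel_bl_tr_iff`), which
comes from the checkerboard orientation of circles; it also makes the signs around a square
consistent (`saddleSign_comm`).

The canonical class of `o'` has homological degree `nMinus o' - nMinus o`, so `H^0` is spanned by
the classes of those `o'` with `nMinus o' = nMinus o`. Because `E_∞` is the associated graded of
homology (`eInftyNeZero_iff`), its lowest nonzero level in degree 0 is the largest `j` for which all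
of `H^0` comes from `𝓕_j`, which is the minimum of the filtration levels of these spanning classes
(`isSMin_of_canonicalIn`). An orientation attaining the minimum is the required one. Equal `nMinus`
forces equal total linking number (`totalLinkingNumber_eq`), and the levels depend only on the prime
field, because everything is defined by integer coefficients (`CanonicalIn.map`). -/

/-! ### Cycles of a permutation multiplied by a transposition -/

namespace Equiv.Perm

variable {α : Type*} [DecidableEq α] [Finite α] {σ : Perm α} {x y : α}

/-- From `x` the product jumps to `σ y` and then follows the `σ`-cycle of `y`, which avoids `x`,
until its first return to `y`. -/
theorem sameCycle_mul_swap_of_not_sameCycle (h : ¬ σ.SameCycle x y) :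
    (σ * swap x y).SameCycle x y := by
  classical
  have hex : ∃ n, 0 < n ∧ (σ ^ n) y = y :=
    ⟨orderOf σ, orderOf_pos σ, by rw [pow_orderOf_eq_one]; rfl⟩
  obtain ⟨hn, hny⟩ := Nat.find_spec hex
  have hmin : ∀ i, 0 < i → i < Nat.find hex → (σ ^ i) y ≠ y := fun i h0 hi he =>
    Nat.find_min hex hi ⟨h0, he⟩
  have key : ∀ i, i + 1 ≤ Nat.find hex → ((σ * swap x y) ^ (i + 1)) x = (σ ^ (i + 1)) y := by
    intro i
    induction i with
    | zero => intro _; simp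
    | succ i ih =>
      intro hi
      rw [pow_succ', mul_apply, ih (by omega), mul_apply, swap_apply_of_ne_of_ne,
        pow_succ' σ (i + 1), mul_apply]
      · intro he
        exact h (SameCycle.symm ⟨(i + 1 : ℕ), by rw [zpow_natCast]; exact he⟩)
      · exact hmin _ (by omega) (by omega)
  refine ⟨(Nat.find hex : ℕ), ?_⟩
  rw [zpow_natCast]
  have := key (Nat.find hex - 1) (by omega)
  rw [Nat.sub_add_cancel hn] at this
  rw [this, hny]

/-- If `n` is least with `σ ^ n x = y`, the product sends `y` to `σ x`, so the orbit of `y` stays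
inside `σ x, …, σ ^ n x = y`. This segment does not contain `x`. -/
theorem not_sameCycle_mul_swap_of_sameCycle (hxy : x ≠ y) (h : σ.SameCycle x y) :
    ¬ (σ * swap x y).SameCycle x y := by
  classical
  have hex : ∃ n : ℕ, (σ ^ n) x = y := h.exists_nat_pow_eq
  have hn := Nat.find_spec hex
  have hn0 : 0 < Nat.find hex := by
    rcases Nat.eq_zero_or_pos (Nat.find hex) with h0 | h0
    · rw [h0] at hn
      exact absurd hn hxy
    · exact h0
  have hx : ∀ i, 0 < i → i ≤ Nat.find hex → (σ ^ i) x ≠ x := by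
    intro i h0 hi he
    refine Nat.find_min hex (m := Nat.find hex - i) (by omega) ?_
    have h1 : (σ ^ (Nat.find hex - i + i)) x = y := by rw [Nat.sub_add_cancel hi, hn]
    rwa [pow_add, mul_apply, he] at h1
  have key : ∀ k : ℕ, ∃ i, 0 < i ∧ i ≤ Nat.find hex ∧ ((σ * swap x y) ^ k) y = (σ ^ i) x := by
    intro k
    induction k with
    | zero => exact ⟨Nat.find hex, hn0, le_rfl, hn.symm⟩
    | succ k ih =>
      obtain ⟨i, h0, hi, he⟩ := ih
      rw [pow_succ', mul_apply, he]
      rcases hi.eq_or_lt with rfl | hlt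
      · exact ⟨1, one_pos, hn0, by simp [hn]⟩
      · refine ⟨i + 1, by omega, hlt, ?_⟩
        rw [mul_apply, swap_apply_of_ne_of_ne (hx i h0 hi) (Nat.find_min hex hlt), pow_succ',
          mul_apply]
  intro hs
  obtain ⟨k, hk⟩ := hs.symm.exists_nat_pow_eq
  obtain ⟨i, h0, hi, he⟩ := key k
  exact hx i h0 hi (he.symm.trans hk)

end Equiv.Perm

/-! ### Circles of a smoothing as cycles of a permutation -/

namespace LinkDiagram

variable {D : LinkDiagram}

theorem point_ext {p q : D.Point} (h₁ : (p.1 : ℕ) = q.1) (h₂ : (p.2 : ℕ) = q.2) : p = q :=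
  at_unique ⟨h₁, h₂⟩ ⟨rfl, rfl⟩

/-- Slice `k` of the smoothing `v` contains an arc joining two points of its bottom line. -/
def BottomTurn (v : D.State) (k : Fin D.numSlices) : Prop :=
  D.kind k = SliceKind.cap ∨ ∃ h, smoothing v ⟨k, h⟩ = CrossingMode.horizontal

/-- Slice `k` of the smoothing `v` contains an arc joining two points of its top line. -/
def TopTurn (v : D.State) (k : Fin D.numSlices) : Prop :=
  D.kind k = SliceKind.cup ∨ ∃ h, smoothing v ⟨k, h⟩ = CrossingMode.horizontal

open Classical in
/-- The point `i` at the bottom of slice `k` is joined to the point `j` at its top. -/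
def Passes (v : D.State) (k : Fin D.numSlices) (i j : ℕ) : Prop :=
  (i < D.pos k ∧ j = i) ∨
    (D.pos k + (if BottomTurn v k then 2 else 0) ≤ i ∧
      j + (if BottomTurn v k then 2 else 0) = i + (if TopTurn v k then 2 else 0))

/-- `i` and `j` are the two positions `n` and `n + 1`, in either order. -/
def Turns (n i j : ℕ) : Prop := (i = n ∧ j = n + 1) ∨ (i = n + 1 ∧ j = n)

/-- The arc above `p` ends in `q`. -/
def Above (v : D.State) (p q : D.Point) : Prop :=
  ∃ k : Fin D.numSlices, (p.1 : ℕ) = k ∧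
    (((q.1 : ℕ) = k + 1 ∧ Passes v k p.2 q.2) ∨
      ((q.1 : ℕ) = k ∧ BottomTurn v k ∧ Turns (D.pos k) p.2 q.2))

/-- The arc below `p` ends in `q`. -/
def Below (v : D.State) (p q : D.Point) : Prop :=
  ∃ k : Fin D.numSlices, (p.1 : ℕ) = k + 1 ∧
    (((q.1 : ℕ) = k ∧ Passes v k q.2 p.2) ∨
      ((q.1 : ℕ) = k + 1 ∧ TopTurn v k ∧ Turns (D.pos k) p.2 q.2))

theorem smoothing_ne_through (v : D.State) (c : D.Crossing) :
    smoothing v c ≠ CrossingMode.through := by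
  unfold smoothing
  split_ifs <;> simp

theorem smoothing_eq_vertical_iff (v : D.State) (c : D.Crossing) :
    smoothing v c = CrossingMode.vertical ↔ smoothing v c ≠ CrossingMode.horizontal := by
  unfold smoothing
  split_ifs <;> simp

theorem bottomTurn_cup {v : D.State} {k : Fin D.numSlices} (h : D.kind k = SliceKind.cup) :
    ¬ BottomTurn v k := by
  rintro (h' | ⟨h', -⟩) <;> rw [h] at h' <;> simp [SliceKind.isCross] at h'

theorem topTurn_cap {v : D.State} {k : Fin D.numSlices} (h : D.kind k = SliceKind.cap) :
    ¬ TopTurn v k := by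
  rintro (h' | ⟨h', -⟩) <;> rw [h] at h' <;> simp [SliceKind.isCross] at h'

theorem bottomTurn_cross {v : D.State} (c : D.Crossing) :
    BottomTurn v c.1 ↔ smoothing v c = CrossingMode.horizontal := by
  obtain ⟨k, hk⟩ := c
  refine ⟨?_, fun h => .inr ⟨hk, h⟩⟩
  rintro (h | ⟨_, h⟩)
  · rw [h] at hk
    cases hk
  · exact h

theorem topTurn_cross {v : D.State} (c : D.Crossing) :
    TopTurn v c.1 ↔ smoothing v c = CrossingMode.horizontal := by
  obtain ⟨k, hk⟩ := c
  refine ⟨?_, fun h => .inr ⟨hk, h⟩⟩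
  rintro (h | ⟨_, h⟩)
  · rw [h] at hk
    cases hk
  · exact h

open Classical in
-- Puts `fits` into a form uniform in the kind of slice, so that later position arithmetic only has
-- to distinguish whether there are turns.
theorem fits_turns (v : D.State) (k : Fin D.numSlices) :
    D.pos k + (if BottomTurn v k then 2 else 0) ≤ D.width k.castSucc ∧
      D.width k.succ + (if BottomTurn v k then 2 else 0) =
        D.width k.castSucc + (if TopTurn v k then 2 else 0) := by
  have hf := D.fits k
  cases hk : D.kind k with
  | cup =>
    rw [hk] at hf
    obtain ⟨h1, h2⟩ := hf
    rw [if_neg (bottomTurn_cup hk), if_pos (show TopTurn v k from .inl hk)]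
    omega
  | cap =>
    rw [hk] at hf
    obtain ⟨h1, h2⟩ := hf
    rw [if_pos (show BottomTurn v k from .inl hk), if_neg (topTurn_cap hk)]
    omega
  | cross b =>
    rw [hk] at hf
    obtain ⟨h1, h2⟩ := hf
    have hc : (D.kind k).isCross = true := by rw [hk]; rfl
    have hb := bottomTurn_cross (v := v) ⟨k, hc⟩
    have ht := topTurn_cross (v := v) ⟨k, hc⟩
    simp only at hb ht
    by_cases h : smoothing v ⟨k, hc⟩ = CrossingMode.horizontal
    · rw [if_pos (hb.2 h), if_pos (ht.2 h)]
      omega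
    · rw [if_neg (mt hb.1 h), if_neg (mt ht.1 h)]
      omega

theorem width_eq {a b : Fin (D.numSlices + 1)} (h : (a : ℕ) = b) : D.width a = D.width b := by
  rw [Fin.ext h]

theorem exists_at {a : Fin (D.numSlices + 1)} {j : ℕ} (h : j < D.width a) :
    ∃ q : D.Point, D.At q a j :=
  ⟨⟨a, j, h⟩, rfl, rfl⟩

theorem exists_above (v : D.State) (p : D.Point) : ∃ q, Above v p q := by
  classical
  have hp := p.2.2
  have hlt : (p.1 : ℕ) < D.numSlices := by
    by_contra hcon
    have h1 : (p.1 : ℕ) = Fin.last D.numSlices := by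
      have := p.1.2
      simp only [Fin.val_last]
      omega
    have h2 := width_eq h1
    rw [D.width_last] at h2
    omega
  obtain ⟨h1, h2⟩ := fits_turns v ⟨p.1, hlt⟩
  have h3 : D.width (Fin.castSucc ⟨p.1, hlt⟩) = D.width p.1 := width_eq rfl
  rw [h3] at h1 h2
  by_cases hj : (p.2 : ℕ) < D.pos ⟨p.1, hlt⟩
  · obtain ⟨q, hq1, hq2⟩ := exists_at (D := D) (a := Fin.succ ⟨p.1, hlt⟩) (j := p.2) (by
      split_ifs at h1 h2 <;> omega)
    exact ⟨q, ⟨p.1, hlt⟩, rfl, .inl ⟨hq1, .inl ⟨hj, hq2⟩⟩⟩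
  by_cases hj' : D.pos ⟨p.1, hlt⟩ + (if BottomTurn v ⟨p.1, hlt⟩ then 2 else 0) ≤ p.2
  · obtain ⟨q, hq1, hq2⟩ := exists_at (D := D) (a := Fin.succ ⟨p.1, hlt⟩)
      (j := p.2 + (if TopTurn v ⟨p.1, hlt⟩ then 2 else 0) -
        (if BottomTurn v ⟨p.1, hlt⟩ then 2 else 0)) (by
        split_ifs at h1 h2 hj' ⊢ <;> omega)
    refine ⟨q, ⟨p.1, hlt⟩, rfl, .inl ⟨hq1, .inr ⟨hj', ?_⟩⟩⟩
    rw [hq2]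
    split_ifs at hj' ⊢ <;> omega
  have hb : BottomTurn v ⟨p.1, hlt⟩ := by
    by_contra hb
    rw [if_neg hb] at hj'
    omega
  rw [if_pos hb] at hj' h1 h2
  -- The reflection `j ↦ 2 * pos + 1 - j` exchanges the two positions joined by the turn.
  obtain ⟨q, hq1, hq2⟩ := exists_at (D := D) (a := p.1)
    (j := 2 * D.pos ⟨p.1, hlt⟩ + 1 - p.2) (by omega)
  refine ⟨q, ⟨p.1, hlt⟩, rfl, .inr ⟨hq1, hb, ?_⟩⟩
  unfold Turns
  omega

theorem exists_below (v : D.State) (p : D.Point) : ∃ q, Below v p q := by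
  classical
  have hp := p.2.2
  have h0 : 0 < (p.1 : ℕ) := by
    by_contra hcon
    have h1 : (p.1 : ℕ) = (0 : Fin (D.numSlices + 1)) := by
      simp only [Fin.val_zero]
      omega
    have h2 := width_eq h1
    rw [D.width_zero] at h2
    omega
  have hlt : (p.1 : ℕ) - 1 < D.numSlices := by
    have := p.1.2
    omega
  obtain ⟨h1, h2⟩ := fits_turns v ⟨p.1 - 1, hlt⟩
  have h3 : D.width (Fin.succ ⟨p.1 - 1, hlt⟩) = D.width p.1 :=
    width_eq (by simp only [Fin.val_succ]; omega)
  have hk : (p.1 : ℕ) = (⟨p.1 - 1, hlt⟩ : Fin D.numSlices) + 1 := by simp only; omega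
  rw [h3] at h2
  by_cases hj : (p.2 : ℕ) < D.pos ⟨p.1 - 1, hlt⟩
  · obtain ⟨q, hq1, hq2⟩ := exists_at (D := D) (a := Fin.castSucc ⟨p.1 - 1, hlt⟩) (j := p.2) (by
      split_ifs at h1 h2 <;> omega)
    exact ⟨q, ⟨p.1 - 1, hlt⟩, hk, .inl ⟨hq1, .inl ⟨hq2 ▸ hj, hq2.symm⟩⟩⟩
  by_cases hj' : D.pos ⟨p.1 - 1, hlt⟩ + (if TopTurn v ⟨p.1 - 1, hlt⟩ then 2 else 0) ≤ p.2
  · obtain ⟨q, hq1, hq2⟩ := exists_at (D := D) (a := Fin.castSucc ⟨p.1 - 1, hlt⟩)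
      (j := p.2 + (if BottomTurn v ⟨p.1 - 1, hlt⟩ then 2 else 0) -
        (if TopTurn v ⟨p.1 - 1, hlt⟩ then 2 else 0)) (by
        split_ifs at h1 h2 hj' ⊢ <;> omega)
    refine ⟨q, ⟨p.1 - 1, hlt⟩, hk, .inl ⟨hq1, .inr ⟨?_, ?_⟩⟩⟩ <;> rw [hq2] <;>
      split_ifs at hj' ⊢ <;> omega
  have hb : TopTurn v ⟨p.1 - 1, hlt⟩ := by
    by_contra hb
    rw [if_neg hb] at hj'
    omega
  rw [if_pos hb] at hj' h2
  obtain ⟨q, hq1, hq2⟩ := exists_at (D := D) (a := p.1)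
    (j := 2 * D.pos ⟨p.1 - 1, hlt⟩ + 1 - p.2) (by split_ifs at h1 h2 <;> omega)
  refine ⟨q, ⟨p.1 - 1, hlt⟩, hk, .inr ⟨hq1.trans hk, hb, ?_⟩⟩
  unfold Turns
  omega

theorem Above.unique {v : D.State} {p q q' : D.Point} (h : Above v p q) (h' : Above v p q') :
    q = q' := by
  classical
  obtain ⟨k, hk, h⟩ := h
  obtain ⟨k', hk', h'⟩ := h'
  obtain rfl : k = k' := Fin.ext (hk.symm.trans hk')
  unfold Passes Turns at h h'
  by_cases hb : BottomTurn v k <;>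
    simp only [hb, if_true, if_false, true_and, false_and, and_false, or_false] at h h' <;>
    exact point_ext (by omega) (by omega)

theorem Below.unique {v : D.State} {p q q' : D.Point} (h : Below v p q) (h' : Below v p q') :
    q = q' := by
  classical
  obtain ⟨k, hk, h⟩ := h
  obtain ⟨k', hk', h'⟩ := h'
  obtain rfl : k = k' := Fin.ext (by omega)
  unfold Passes Turns at h h'
  by_cases hb : TopTurn v k <;>
    simp only [hb, if_true, if_false, true_and, false_and, and_false, or_false] at h h' <;>
    exact point_ext (by omega) (by split_ifs at h h' <;> omega)

/-- The checkerboard orientation of the circles of a smoothing: `p` is passed upwards. The parameter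
`e` exchanges the two colors. -/
def Ascends (e : ℕ) (p : D.Point) : Prop := Even ((p.2 : ℕ) + e)

/-- Arcs to the next line shift positions by an even number and are traversed back from above; turns
change the parity and are traversed back on the same side. So the checkerboard direction is
consistent along every arc. -/
theorem Above.symm {v : D.State} {p q : D.Point} (e : ℕ) (h : Above v p q) :
    (Ascends e p ↔ Ascends e q) ∧ Below v q p ∨ (Ascends e p ↔ ¬ Ascends e q) ∧ Above v q p := by
  classical
  obtain ⟨k, hk, ⟨h1, h2⟩ | ⟨h1, h2, h3⟩⟩ := h
  · refine .inl ⟨?_, k, h1, .inl ⟨hk, h2⟩⟩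
    unfold Passes at h2
    unfold Ascends
    simp only [Nat.even_iff]
    split_ifs at h2 <;> omega
  · refine .inr ⟨?_, k, h1, .inr ⟨hk, h2, ?_⟩⟩
    · unfold Turns at h3
      unfold Ascends
      simp only [Nat.even_iff]
      omega
    · unfold Turns at h3 ⊢
      omega

theorem Below.symm {v : D.State} {p q : D.Point} (e : ℕ) (h : Below v p q) :
    (Ascends e p ↔ Ascends e q) ∧ Above v q p ∨ (Ascends e p ↔ ¬ Ascends e q) ∧ Below v q p := by
  classical
  obtain ⟨k, hk, ⟨h1, h2⟩ | ⟨h1, h2, h3⟩⟩ := h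
  · refine .inl ⟨?_, k, h1, .inl ⟨hk, h2⟩⟩
    unfold Passes at h2
    unfold Ascends
    simp only [Nat.even_iff]
    split_ifs at h2 <;> omega
  · refine .inr ⟨?_, k, h1, .inr ⟨hk, h2, ?_⟩⟩
    · unfold Turns at h3
      unfold Ascends
      simp only [Nat.even_iff]
      omega
    · unfold Turns at h3 ⊢
      omega

theorem above_or_below_of_arc {v : D.State} {p q : D.Point} (h : D.Arc (smoothing v) p q) :
    Above v p q ∨ Below v p q := by
  classical
  cases h with
  | left k j p q hj hp hq =>
    exact .inl ⟨k, hp.1, .inl ⟨hq.1, .inl ⟨hp.2 ▸ hj, hq.2.trans hp.2.symm⟩⟩⟩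
  | right_of_cup k j p q hk hj hp hq =>
    refine .inl ⟨k, hp.1, .inl ⟨hq.1, .inr ?_⟩⟩
    rw [if_neg (bottomTurn_cup hk), if_pos (show TopTurn v k from .inl hk), hp.2, hq.2]
    exact ⟨hj, rfl⟩
  | right_of_cap k j p q hk hj hp hq =>
    refine .inl ⟨k, hp.1, .inl ⟨hq.1, .inr ?_⟩⟩
    rw [if_pos (show BottomTurn v k from .inl hk), if_neg (topTurn_cap hk), hp.2, hq.2]
    omega
  | right_of_cross c j p q hj hp hq =>
    refine .inl ⟨c.1, hp.1, .inl ⟨hq.1, .inr ?_⟩⟩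
    rw [hp.2, hq.2]
    by_cases hm : smoothing v c = CrossingMode.horizontal
    · rw [if_pos ((bottomTurn_cross c).2 hm), if_pos ((topTurn_cross c).2 hm)]
      omega
    · rw [if_neg (mt (bottomTurn_cross c).1 hm), if_neg (mt (topTurn_cross c).1 hm)]
      omega
  | cup k p q hk hp hq =>
    exact .inr ⟨k, hp.1, .inr ⟨hq.1, .inl hk, .inl ⟨hp.2, hq.2⟩⟩⟩
  | cap k p q hk hp hq =>
    exact .inl ⟨k, hp.1, .inr ⟨hq.1, .inl hk, .inl ⟨hp.2, hq.2⟩⟩⟩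
  | through₁ c p q hm => exact absurd hm (smoothing_ne_through v c)
  | through₂ c p q hm => exact absurd hm (smoothing_ne_through v c)
  | vertical₁ c p q hm hp hq =>
    refine .inl ⟨c.1, hp.1, .inl ⟨hq.1, .inr ?_⟩⟩
    rw [hp.2, hq.2]
    simp [bottomTurn_cross, topTurn_cross, hm]
  | vertical₂ c p q hm hp hq =>
    refine .inl ⟨c.1, hp.1, .inl ⟨hq.1, .inr ?_⟩⟩
    rw [hp.2, hq.2]
    simp [bottomTurn_cross, topTurn_cross, hm]
  | horizontal₁ c p q hm hp hq =>
    exact .inl ⟨c.1, hp.1, .inr ⟨hq.1, (bottomTurn_cross c).2 hm, .inl ⟨hp.2, hq.2⟩⟩⟩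
  | horizontal₂ c p q hm hp hq =>
    exact .inr ⟨c.1, hp.1, .inr ⟨hq.1, (topTurn_cross c).2 hm, .inl ⟨hp.2, hq.2⟩⟩⟩

theorem arc_of_passes {v : D.State} {k : Fin D.numSlices} {p q : D.Point}
    (hp : (p.1 : ℕ) = k) (hq : (q.1 : ℕ) = k + 1) (h : Passes v k p.2 q.2) :
    D.Arc (smoothing v) p q := by
  rcases h with ⟨h1, h2⟩ | ⟨h1, h2⟩
  · exact .left k p.2 p q h1 ⟨hp, rfl⟩ ⟨hq, h2⟩
  cases hk : D.kind k with
  | cup =>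
    rw [if_neg (bottomTurn_cup hk)] at h1 h2
    rw [if_pos (show TopTurn v k from .inl hk)] at h2
    exact .right_of_cup k p.2 p q hk h1 ⟨hp, rfl⟩ ⟨hq, h2⟩
  | cap =>
    rw [if_pos (show BottomTurn v k from .inl hk)] at h1 h2
    rw [if_neg (topTurn_cap hk)] at h2
    exact .right_of_cap k q.2 p q hk (by omega) ⟨hp, h2.symm⟩ ⟨hq, rfl⟩
  | cross b =>
    have hc : (D.kind k).isCross = true := by rw [hk]; rfl
    obtain ⟨c, rfl⟩ : ∃ c : D.Crossing, c.1 = k := ⟨⟨k, hc⟩, rfl⟩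
    by_cases hm : smoothing v c = CrossingMode.horizontal
    · rw [if_pos ((bottomTurn_cross c).2 hm)] at h1 h2
      rw [if_pos ((topTurn_cross c).2 hm)] at h2
      exact .right_of_cross c p.2 p q h1 ⟨hp, rfl⟩ ⟨hq, by omega⟩
    · have hm' := (smoothing_eq_vertical_iff v c).2 hm
      rw [if_neg (mt (bottomTurn_cross c).1 hm)] at h1 h2
      rw [if_neg (mt (topTurn_cross c).1 hm)] at h2
      by_cases hj : (p.2 : ℕ) = D.pos c.1
      · exact .vertical₁ c p q hm' ⟨hp, hj⟩ ⟨hq, by omega⟩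
      by_cases hj' : (p.2 : ℕ) = D.pos c.1 + 1
      · exact .vertical₂ c p q hm' ⟨hp, hj'⟩ ⟨hq, by omega⟩
      exact .right_of_cross c p.2 p q (by omega) ⟨hp, rfl⟩ ⟨hq, by omega⟩

theorem Above.rel {v : D.State} {p q : D.Point} (h : Above v p q) :
    D.curveSetoid (smoothing v) p q := by
  obtain ⟨k, hk, ⟨h1, h2⟩ | ⟨h1, h2, h3⟩⟩ := h
  · exact .rel _ _ (arc_of_passes hk h1 h2)
  · rcases h2 with h2 | ⟨hc, h2⟩ <;> rcases h3 with h3 | h3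
    · exact .rel _ _ (.cap k p q h2 ⟨hk, h3.1⟩ ⟨h1, h3.2⟩)
    · exact .symm _ _ (.rel _ _ (.cap k q p h2 ⟨h1, h3.2⟩ ⟨hk, h3.1⟩))
    · exact .rel _ _ (.horizontal₁ ⟨k, hc⟩ p q h2 ⟨hk, h3.1⟩ ⟨h1, h3.2⟩)
    · exact .symm _ _ (.rel _ _ (.horizontal₁ ⟨k, hc⟩ q p h2 ⟨h1, h3.2⟩ ⟨hk, h3.1⟩))

theorem Below.rel {v : D.State} {p q : D.Point} (h : Below v p q) :
    D.curveSetoid (smoothing v) p q := by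
  obtain ⟨k, hk, ⟨h1, h2⟩ | ⟨h1, h2, h3⟩⟩ := h
  · exact .symm _ _ (.rel _ _ (arc_of_passes h1 hk h2))
  · rcases h2 with h2 | ⟨hc, h2⟩ <;> rcases h3 with h3 | h3
    · exact .rel _ _ (.cup k p q h2 ⟨hk, h3.1⟩ ⟨h1, h3.2⟩)
    · exact .symm _ _ (.rel _ _ (.cup k q p h2 ⟨h1, h3.2⟩ ⟨hk, h3.1⟩))
    · exact .rel _ _ (.horizontal₂ ⟨k, hc⟩ p q h2 ⟨hk, h3.1⟩ ⟨h1, h3.2⟩)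
    · exact .symm _ _ (.rel _ _ (.horizontal₂ ⟨k, hc⟩ q p h2 ⟨h1, h3.2⟩ ⟨hk, h3.1⟩))

open Classical in
theorem exists_next (e : ℕ) (v : D.State) (p : D.Point) :
    ∃ q, if Ascends e p then Above v p q else Below v p q := by
  split_ifs
  · exact exists_above v p
  · exact exists_below v p

open Classical in
theorem exists_prev (e : ℕ) (v : D.State) (p : D.Point) :
    ∃ q, if Ascends e p then Below v p q else Above v p q := by
  split_ifs
  · exact exists_below v p
  · exact exists_above v p

open Classical in
/-- The permutation that moves each point to the next one along its circle, with respect to the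
checkerboard orientation. -/
noncomputable def next (e : ℕ) (v : D.State) : Equiv.Perm D.Point where
  toFun := (Classical.axiomOfChoice (exists_next e v)).choose
  invFun := (Classical.axiomOfChoice (exists_prev e v)).choose
  left_inv := by
    have h1 := (Classical.axiomOfChoice (exists_next e v)).choose_spec
    have h2 := (Classical.axiomOfChoice (exists_prev e v)).choose_spec
    generalize (Classical.axiomOfChoice (exists_next e v)).choose = f at h1 ⊢
    generalize (Classical.axiomOfChoice (exists_prev e v)).choose = g at h2 ⊢
    intro p
    specialize h1 p
    specialize h2 (f p)
    -- The directions at `p` and `f p` agree exactly when the arc is not a turn; in every case the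
    -- arc that `g` follows from `f p` is the one just traversed.
    by_cases hp : Ascends e p <;> by_cases hq : Ascends e (f p) <;>
      simp only [hp, hq, if_true, if_false] at h1 h2 <;>
      have h3 := h1.symm e <;>
      simp only [hp, hq, not_true, not_false_iff, iff_true, iff_false, iff_self, true_and,
        false_and, or_false, false_or] at h3 <;>
      exact h2.unique h3
  right_inv := by
    have h1 := (Classical.axiomOfChoice (exists_next e v)).choose_spec
    have h2 := (Classical.axiomOfChoice (exists_prev e v)).choose_spec
    generalize (Classical.axiomOfChoice (exists_next e v)).choose = f at h1 ⊢
    generalize (Classical.axiomOfChoice (exists_prev e v)).choose = g at h2 ⊢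
    intro p
    specialize h2 p
    specialize h1 (g p)
    by_cases hp : Ascends e p <;> by_cases hq : Ascends e (g p) <;>
      simp only [hp, hq, if_true, if_false] at h1 h2 <;>
      have h3 := h2.symm e <;>
      simp only [hp, hq, not_true, not_false_iff, iff_true, iff_false, iff_self, true_and,
        false_and, or_false, false_or] at h3 <;>
      exact h1.unique h3

open Classical in
theorem next_spec (e : ℕ) (v : D.State) (p : D.Point) :
    if Ascends e p then Above v p (next e v p) else Below v p (next e v p) :=
  (Classical.axiomOfChoice (exists_next e v)).choose_spec p

theorem next_eq_of_above {e : ℕ} {v : D.State} {p q : D.Point} (hp : Ascends e p)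
    (h : Above v p q) : next e v p = q := by
  have h1 := next_spec e v p
  rw [if_pos hp] at h1
  exact h1.unique h

theorem next_eq_of_below {e : ℕ} {v : D.State} {p q : D.Point} (hp : ¬ Ascends e p)
    (h : Below v p q) : next e v p = q := by
  have h1 := next_spec e v p
  rw [if_neg hp] at h1
  exact h1.unique h

theorem rel_next (e : ℕ) (v : D.State) (p : D.Point) :
    D.curveSetoid (smoothing v) p (next e v p) := by
  have h1 := next_spec e v p
  split_ifs at h1
  · exact h1.rel
  · exact h1.rel

/-- Every arc is one step of `next`, forwards or backwards, and every step of `next` runs along an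
arc. The permutation lemmas thus apply to circles. -/
theorem rel_iff_sameCycle (e : ℕ) (v : D.State) (p q : D.Point) :
    D.curveSetoid (smoothing v) p q ↔ (next e v).SameCycle p q := by
  constructor
  · intro h
    induction h with
    | refl => exact .refl _ _
    | symm _ _ _ ih => exact ih.symm
    | trans _ _ _ _ _ ih₁ ih₂ => exact ih₁.trans ih₂
    | rel p q h =>
      have hn {p q : D.Point} (h : next e v p = q) : (next e v).SameCycle p q :=
        ⟨1, by simpa using h⟩
      rcases above_or_below_of_arc h with h | h
      · by_cases hp : Ascends e p
        · exact hn (next_eq_of_above hp h)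
        · rcases h.symm e with ⟨h1, h2⟩ | ⟨h1, h2⟩
          · exact (hn (next_eq_of_below (mt h1.2 hp) h2)).symm
          · exact (hn (next_eq_of_above (by tauto) h2)).symm
      · by_cases hp : Ascends e p
        · rcases h.symm e with ⟨h1, h2⟩ | ⟨h1, h2⟩
          · exact (hn (next_eq_of_above (h1.1 hp) h2)).symm
          · exact (hn (next_eq_of_below (by tauto) h2)).symm
        · exact hn (next_eq_of_below hp h)
  · intro h
    obtain ⟨n, rfl⟩ := h.exists_nat_pow_eq
    clear h
    induction n with
    | zero => exact .refl _
    | succ n ih =>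
      rw [pow_succ', Equiv.Perm.mul_apply]
      exact .trans _ _ _ ih (rel_next e v _)

end LinkDiagram

/-! ### The effect of a saddle on the circles -/

namespace LinkDiagram

variable {D : LinkDiagram}

/-- The top left endpoint of a crossing. -/
def tl (c : D.Crossing) : D.Point := ⟨c.1.succ, ⟨D.pos c.1, by
  have h := (tr c).2.2
  simp only [tr] at h
  omega⟩⟩

theorem bl_ne_tr (c : D.Crossing) : bl c ≠ tr c := fun h => by
  have h' := congrArg (fun p : D.Point => (p.1 : ℕ)) h
  simp [bl, tr] at h'

/-- `p` is one of the four endpoints of the crossing `c`. -/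
def IsEndpoint (c : D.Crossing) (p : D.Point) : Prop := p = bl c ∨ p = br c ∨ p = tl c ∨ p = tr c

theorem Arc.of_eq_off {m m' : D.Crossing → CrossingMode} {c : D.Crossing}
    (hm : ∀ c', c' ≠ c → m c' = m' c') {p q : D.Point} (h : D.Arc m p q) :
    D.Arc m' p q ∨ IsEndpoint c p ∧ IsEndpoint c q := by
  cases h with
  | left k j p q hj hp hq => exact .inl (.left k j p q hj hp hq)
  | right_of_cup k j p q hk hj hp hq => exact .inl (.right_of_cup k j p q hk hj hp hq)
  | right_of_cap k j p q hk hj hp hq => exact .inl (.right_of_cap k j p q hk hj hp hq)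
  | right_of_cross c' j p q hj hp hq => exact .inl (.right_of_cross c' j p q hj hp hq)
  | cup k p q hk hp hq => exact .inl (.cup k p q hk hp hq)
  | cap k p q hk hp hq => exact .inl (.cap k p q hk hp hq)
  | through₁ c' p q h hp hq =>
    rcases eq_or_ne c' c with rfl | hc
    · exact .inr ⟨.inl (at_unique hp ⟨rfl, rfl⟩), .inr (.inr (.inr (at_unique hq ⟨rfl, rfl⟩)))⟩
    · exact .inl (.through₁ c' p q (hm c' hc ▸ h) hp hq)
  | through₂ c' p q h hp hq =>
    rcases eq_or_ne c' c with rfl | hc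
    · exact .inr ⟨.inr (.inl (at_unique hp ⟨rfl, rfl⟩)),
        .inr (.inr (.inl (at_unique hq ⟨rfl, rfl⟩)))⟩
    · exact .inl (.through₂ c' p q (hm c' hc ▸ h) hp hq)
  | vertical₁ c' p q h hp hq =>
    rcases eq_or_ne c' c with rfl | hc
    · exact .inr ⟨.inl (at_unique hp ⟨rfl, rfl⟩), .inr (.inr (.inl (at_unique hq ⟨rfl, rfl⟩)))⟩
    · exact .inl (.vertical₁ c' p q (hm c' hc ▸ h) hp hq)
  | vertical₂ c' p q h hp hq =>
    rcases eq_or_ne c' c with rfl | hc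
    · exact .inr ⟨.inr (.inl (at_unique hp ⟨rfl, rfl⟩)),
        .inr (.inr (.inr (at_unique hq ⟨rfl, rfl⟩)))⟩
    · exact .inl (.vertical₂ c' p q (hm c' hc ▸ h) hp hq)
  | horizontal₁ c' p q h hp hq =>
    rcases eq_or_ne c' c with rfl | hc
    · exact .inr ⟨.inl (at_unique hp ⟨rfl, rfl⟩), .inr (.inl (at_unique hq ⟨rfl, rfl⟩))⟩
    · exact .inl (.horizontal₁ c' p q (hm c' hc ▸ h) hp hq)
  | horizontal₂ c' p q h hp hq =>
    rcases eq_or_ne c' c with rfl | hc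
    · exact .inr ⟨.inr (.inr (.inl (at_unique hp ⟨rfl, rfl⟩))),
        .inr (.inr (.inr (at_unique hq ⟨rfl, rfl⟩)))⟩
    · exact .inl (.horizontal₂ c' p q (hm c' hc ▸ h) hp hq)

/-- The states `v` and `w` differ at the crossing `c` and nowhere else. -/
structure Adjacent (c : D.Crossing) (v w : D.State) : Prop where
  eq_off : ∀ c', c' ≠ c → v c' = w c'
  ne : v c ≠ w c

namespace Adjacent

variable {c : D.Crossing} {v w : D.State}

theorem symm (h : Adjacent c v w) : Adjacent c w v :=
  ⟨fun c' hc => (h.eq_off c' hc).symm, h.ne.symm⟩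

theorem smoothing_eq (h : Adjacent c v w) (c' : D.Crossing) (hc : c' ≠ c) :
    smoothing v c' = smoothing w c' := by
  unfold smoothing
  rw [h.eq_off c' hc]

theorem smoothing_horizontal_iff (h : Adjacent c v w) :
    smoothing w c = CrossingMode.horizontal ↔ smoothing v c ≠ CrossingMode.horizontal := by
  have h1 := h.ne
  unfold smoothing
  cases h2 : v c <;> cases h3 : w c <;> cases (D.kind c.1).blOver <;> simp_all

end Adjacent

theorem adjacent_update [DecidableEq D.Crossing] {c : D.Crossing} {v : D.State} {b : Bool}
    (h : v c ≠ b) : Adjacent c v (Function.update v c b) :=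
  ⟨fun c' hc => by rw [Function.update_of_ne hc], by rwa [Function.update_self]⟩

open Classical in
theorem above_bl {v : D.State} {c : D.Crossing} :
    Above v (bl c) (if smoothing v c = CrossingMode.horizontal then br c else tl c) := by
  split_ifs with h
  · exact ⟨c.1, rfl, .inr ⟨rfl, (bottomTurn_cross c).2 h, .inl ⟨rfl, rfl⟩⟩⟩
  · refine ⟨c.1, rfl, .inl ⟨rfl, .inr ?_⟩⟩
    rw [if_neg (mt (bottomTurn_cross c).1 h), if_neg (mt (topTurn_cross c).1 h)]
    exact ⟨le_rfl, rfl⟩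

open Classical in
theorem below_tr {v : D.State} {c : D.Crossing} :
    Below v (tr c) (if smoothing v c = CrossingMode.horizontal then tl c else br c) := by
  split_ifs with h
  · exact ⟨c.1, rfl, .inr ⟨rfl, (topTurn_cross c).2 h, .inr ⟨rfl, rfl⟩⟩⟩
  · refine ⟨c.1, rfl, .inl ⟨rfl, .inr ?_⟩⟩
    rw [if_neg (mt (bottomTurn_cross c).1 h), if_neg (mt (topTurn_cross c).1 h)]
    exact ⟨Nat.le_succ _, rfl⟩

theorem ascends_bl (c : D.Crossing) : Ascends (D.pos c.1) (bl c) := by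
  simp [Ascends, bl]

theorem not_ascends_tr (c : D.Crossing) : ¬ Ascends (D.pos c.1) (tr c) := by
  simp only [Ascends, tr, Nat.even_iff]
  omega

namespace Adjacent

variable {c : D.Crossing} {v w : D.State}

theorem bottomTurn_iff (h : Adjacent c v w) {k : Fin D.numSlices} (hk : k ≠ c.1) :
    BottomTurn v k ↔ BottomTurn w k := by
  unfold BottomTurn
  refine or_congr_right (exists_congr fun hc => ?_)
  rw [h.smoothing_eq _ fun he => hk (congrArg Subtype.val he)]

theorem topTurn_iff (h : Adjacent c v w) {k : Fin D.numSlices} (hk : k ≠ c.1) :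
    TopTurn v k ↔ TopTurn w k := by
  unfold TopTurn
  refine or_congr_right (exists_congr fun hc => ?_)
  rw [h.smoothing_eq _ fun he => hk (congrArg Subtype.val he)]

theorem passes_iff (h : Adjacent c v w) {k : Fin D.numSlices} (hk : k ≠ c.1) {i j : ℕ} :
    Passes v k i j ↔ Passes w k i j := by
  classical
  unfold Passes
  rw [if_congr (h.bottomTurn_iff hk) rfl rfl, if_congr (h.topTurn_iff hk) rfl rfl]

theorem passes_cross {i j : ℕ} (h : Passes v c.1 i j) (hi : i ≠ D.pos c.1)
    (hi' : i ≠ D.pos c.1 + 1) : Passes w c.1 i j := by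
  unfold Passes at h ⊢
  have h1 := bottomTurn_cross (v := v) c
  have h2 := topTurn_cross (v := v) c
  have h3 := bottomTurn_cross (v := w) c
  have h4 := topTurn_cross (v := w) c
  by_cases hv : smoothing v c = CrossingMode.horizontal <;>
    by_cases hw : smoothing w c = CrossingMode.horizontal <;>
    simp only [hv, hw, iff_true, iff_false] at h1 h2 h3 h4 <;>
    simp only [h1, h2, h3, h4, if_true, if_false] at h ⊢ <;> omega

theorem above (h : Adjacent c v w) {p q : D.Point} (hp : Ascends (D.pos c.1) p) (hpc : p ≠ bl c)
    (hpq : Above v p q) : Above w p q := by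
  obtain ⟨k, hk, hpq⟩ := hpq
  refine ⟨k, hk, ?_⟩
  by_cases hkc : k = c.1
  · subst hkc
    have h1 : (p.2 : ℕ) ≠ D.pos c.1 := fun he => hpc (point_ext hk he)
    have h2 : (p.2 : ℕ) ≠ D.pos c.1 + 1 := by
      simp only [Ascends, Nat.even_iff] at hp
      omega
    rcases hpq with ⟨h3, h4⟩ | ⟨-, -, h4⟩
    · exact .inl ⟨h3, passes_cross h4 h1 h2⟩
    · unfold Turns at h4
      omega
  · rwa [← h.passes_iff hkc, ← h.bottomTurn_iff hkc]

theorem below (h : Adjacent c v w) {p q : D.Point} (hp : ¬ Ascends (D.pos c.1) p) (hpc : p ≠ tr c)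
    (hpq : Below v p q) : Below w p q := by
  obtain ⟨k, hk, hpq⟩ := hpq
  refine ⟨k, hk, ?_⟩
  by_cases hkc : k = c.1
  · subst hkc
    have h1 : (p.2 : ℕ) ≠ D.pos c.1 + 1 := fun he => hpc (point_ext hk he)
    have h2 : (p.2 : ℕ) ≠ D.pos c.1 := by
      simp only [Ascends, Nat.even_iff] at hp
      omega
    rcases hpq with ⟨h3, h4⟩ | ⟨-, -, h4⟩
    · have h5 : (q.2 : ℕ) = p.2 := by
        unfold Passes at h4
        have h1 := bottomTurn_cross (v := v) c
        have h2 := topTurn_cross (v := v) c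
        by_cases hv : smoothing v c = CrossingMode.horizontal <;>
          simp only [hv, iff_true, iff_false] at h1 h2 <;>
          simp only [h1, h2, if_true, if_false] at h4 <;> omega
      exact .inl ⟨h3, passes_cross h4 (h5 ▸ h2) (h5 ▸ h1)⟩
    · unfold Turns at h4
      omega
  · rwa [← h.passes_iff hkc, ← h.topTurn_iff hkc]

open Classical in
-- With the colours shifted by `pos c`, the only points whose outgoing arc lies at `c` are `bl c`
-- and `tr c`. Their successors are `br c` and `tl c` in some order, and changing the smoothing
-- exchanges them. Every other point keeps its successor.
theorem next_eq (h : Adjacent c v w) :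
    next (D.pos c.1) w = next (D.pos c.1) v * Equiv.swap (bl c) (tr c) := by
  ext1 p
  rw [Equiv.Perm.mul_apply]
  have hbl (v : D.State) := next_eq_of_above (ascends_bl c) (above_bl (v := v) (c := c))
  have htr (v : D.State) := next_eq_of_below (not_ascends_tr c) (below_tr (v := v) (c := c))
  by_cases h1 : p = bl c
  · subst h1
    rw [Equiv.swap_apply_left, hbl, htr]
    simp only [h.smoothing_horizontal_iff]
    split_ifs <;> tauto
  by_cases h2 : p = tr c
  · subst h2
    rw [Equiv.swap_apply_right, hbl, htr]
    simp only [h.smoothing_horizontal_iff]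
    split_ifs <;> tauto
  rw [Equiv.swap_apply_of_ne_of_ne h1 h2]
  have h3 := next_spec (D.pos c.1) v p
  split_ifs at h3 with h4
  · exact next_eq_of_above h4 (h.above h4 h1 h3)
  · exact next_eq_of_below h4 (h.below h4 h2 h3)

/-- A saddle either merges two circles or splits one circle. -/
theorem rel_bl_tr_iff (h : Adjacent c v w) :
    D.curveSetoid (smoothing w) (bl c) (tr c) ↔ ¬ D.curveSetoid (smoothing v) (bl c) (tr c) := by
  classical
  rw [rel_iff_sameCycle (D.pos c.1), rel_iff_sameCycle (D.pos c.1), h.next_eq]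
  exact ⟨fun h1 h2 => Equiv.Perm.not_sameCycle_mul_swap_of_sameCycle (bl_ne_tr c) h2 h1,
    Equiv.Perm.sameCycle_mul_swap_of_not_sameCycle⟩

end Adjacent

/-- The circle of `p` in the smoothing `v` runs through the crossing `c`. -/
def Meets (v : D.State) (c : D.Crossing) (p : D.Point) : Prop :=
  D.curveSetoid (smoothing v) p (bl c) ∨ D.curveSetoid (smoothing v) p (tr c)

theorem Meets.of_rel {v : D.State} {c : D.Crossing} {p q : D.Point}
    (h : D.curveSetoid (smoothing v) p q) (hq : Meets v c q) : Meets v c p :=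
  hq.imp (.trans _ _ _ h) (.trans _ _ _ h)

theorem IsEndpoint.meets {c : D.Crossing} {p : D.Point} (v : D.State) (h : IsEndpoint c p) :
    Meets v c p := by
  have hbl := (above_bl (v := v) (c := c)).rel
  have htr := (below_tr (v := v) (c := c)).rel
  rcases h with rfl | rfl | rfl | rfl
  · exact .inl (.refl _)
  · split_ifs at hbl htr
    · exact .inl (.symm _ _ hbl)
    · exact .inr (.symm _ _ htr)
  · split_ifs at hbl htr
    · exact .inr (.symm _ _ htr)
    · exact .inl (.symm _ _ hbl)
  · exact .inr (.refl _)

namespace Adjacent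

variable {c : D.Crossing} {v w : D.State}

/-- A chain of arcs in `v` either survives in `w` or uses an arc at `c`; in the latter case, cutting
it there leaves both ends on circles of `w` through `c`. -/
theorem rel (h : Adjacent c v w) {p q : D.Point} (hpq : D.curveSetoid (smoothing v) p q) :
    D.curveSetoid (smoothing w) p q ∨ Meets w c p ∧ Meets w c q := by
  induction hpq with
  | rel p q hpq =>
    exact (hpq.of_eq_off h.smoothing_eq).imp (.rel _ _) fun he => ⟨he.1.meets w, he.2.meets w⟩
  | refl p => exact .inl (.refl p)
  | symm p q _ ih => exact ih.imp (.symm _ _) And.symm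
  | trans p q r _ _ ih₁ ih₂ =>
    rcases ih₁ with ih₁ | ih₁ <;> rcases ih₂ with ih₂ | ih₂
    · exact .inl (.trans _ _ _ ih₁ ih₂)
    · exact .inr ⟨.of_rel ih₁ ih₂.1, ih₂.2⟩
    · exact .inr ⟨ih₁.1, .of_rel (.symm _ _ ih₂) ih₁.2⟩
    · exact .inr ⟨ih₁.1, ih₂.2⟩

theorem meets (h : Adjacent c v w) {p : D.Point} (hp : Meets v c p) : Meets w c p := by
  rcases hp with hp | hp
  · exact (h.rel hp).elim .inl And.left
  · exact (h.rel hp).elim .inr And.left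

theorem meets_iff (h : Adjacent c v w) {p : D.Point} : Meets v c p ↔ Meets w c p :=
  ⟨h.meets, h.symm.meets⟩

/-- When `w` is the merged side, all points on circles through `c` form one class of `w`, so `w`
arises from `v` by identifying the classes of `bl c` and `tr c`. This is the hypothesis of
`card_quotient_eq_add_one`. -/
theorem rel_iff_of_rel (h : Adjacent c v w) (hw : D.curveSetoid (smoothing w) (bl c) (tr c))
    {p q : D.Point} : D.curveSetoid (smoothing w) p q ↔
      D.curveSetoid (smoothing v) p q ∨ Meets v c p ∧ Meets v c q := by
  refine ⟨h.symm.rel, fun hpq => ?_⟩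
  have hm {p : D.Point} (hp : Meets w c p) : D.curveSetoid (smoothing w) p (bl c) :=
    hp.elim id fun hp => .trans _ _ _ hp (.symm _ _ hw)
  have hm' {p q : D.Point} (hp : Meets w c p ∧ Meets w c q) : D.curveSetoid (smoothing w) p q :=
    .trans _ _ _ (hm hp.1) (.symm _ _ (hm hp.2))
  rcases hpq with hpq | hpq
  · exact (h.rel hpq).elim id hm'
  · exact hm' (hpq.imp h.meets h.meets)

end Adjacent

/-- Identifying two classes of an equivalence relation on a finite type decreases the number of
classes by one. -/
theorem card_quotient_eq_add_one {α : Type*} [Finite α] (r r' : Setoid α) {x y : α}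
    (hxy : ¬ r x y) (h : ∀ p q, r' p q ↔ r p q ∨ (r p x ∨ r p y) ∧ (r q x ∨ r q y)) :
    Nat.card (Quotient r) = Nat.card (Quotient r') + 1 := by
  classical
  rw [← Finite.card_option]
  refine Nat.card_congr
    -- The class of `y` is sent to `none`; the merged class is represented by the class of `x`.
    { toFun := Quotient.lift (fun p => if r p y then none else some (Quotient.mk r' p)) ?_
      invFun := fun o => o.elim (Quotient.mk r y)
        (Quotient.lift (fun p => if r p y then Quotient.mk r x else Quotient.mk r p) ?_)
      left_inv := ?_
      right_inv := ?_ }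
  · intro p q hpq
    have h1 : r p y ↔ r q y := ⟨fun h => r.trans (r.symm hpq) h, fun h => r.trans hpq h⟩
    simp only [h1]
    split_ifs
    · rfl
    · exact congrArg some (Quotient.sound ((h p q).2 (.inl hpq)))
  · intro p q hpq
    rcases (h p q).1 hpq with hpq | ⟨hp, hq⟩
    · have h1 : r p y ↔ r q y := ⟨fun h => r.trans (r.symm hpq) h, fun h => r.trans hpq h⟩
      simp only [h1]
      split_ifs
      · rfl
      · exact Quotient.sound hpq
    · have key {p} (hp : r p x ∨ r p y) :
          (if r p y then Quotient.mk r x else Quotient.mk r p) = Quotient.mk r x := by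
        split_ifs with h1
        · rfl
        · exact Quotient.sound (hp.resolve_right h1)
      simp only [key hp, key hq]
  · intro C
    induction C using Quotient.inductionOn with
    | h p =>
      by_cases hp : r p y
      · simpa [hp] using Quotient.sound (r.symm hp)
      · simp [hp]
  · intro o
    cases o with
    | none => simp
    | some C =>
      induction C using Quotient.inductionOn with
      | h p =>
        by_cases hp : r p y
        · simp only [Option.elim_some, Quotient.lift_mk, hp, if_true, hxy, if_false]
          exact congrArg some (Quotient.sound ((h x p).2 (.inr ⟨.inl (r.refl x), .inr hp⟩)))
        · simp [hp]

theorem Adjacent.card_circle {c : D.Crossing} {v w : D.State} (h : Adjacent c v w)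
    (hw : D.curveSetoid (smoothing w) (bl c) (tr c)) :
    Nat.card (Circle v) = Nat.card (Circle w) + 1 :=
  card_quotient_eq_add_one _ _ (h.rel_bl_tr_iff.1 hw) fun _ _ => h.rel_iff_of_rel hw

end LinkDiagram

/-! ### Saddle maps in the basis of idempotents -/

namespace LinkDiagram

variable {D : LinkDiagram}

/-- The labelling `f` of the points is constant on the circles of the smoothing `v`. -/
def Compat (v : D.State) (f : D.Point → Bool) : Prop :=
  ∀ p q, D.curveSetoid (smoothing v) p q → f p = f q

theorem compat_of_arc {v : D.State} {f : D.Point → Bool}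
    (h : ∀ p q, D.Arc (smoothing v) p q → f p = f q) : Compat v f := by
  intro p q hpq
  induction hpq with
  | rel p q hpq => exact h p q hpq
  | refl => rfl
  | symm _ _ _ ih => exact ih.symm
  | trans _ _ _ _ _ ih₁ ih₂ => exact ih₁.trans ih₂

/-- Every label of `s` is at most the corresponding value of `f`, where `1 ≤ X` corresponds to
`false ≤ true`. -/
def Dominated (s : D.EnhancedState) (f : D.Point → Bool) : Prop :=
  ∀ p, s.2 (⟦p⟧ : Circle s.1) = true → f p = true

/-- The labels of `s` on the circles of `w` away from the crossing `c` are dominated by `f`. -/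
def DominatedOff (w : D.State) (c : D.Crossing) (s : D.EnhancedState) (f : D.Point → Bool) : Prop :=
  ∀ p, ¬ Meets w c p → s.2 (⟦p⟧ : Circle s.1) = true → f p = true

/-- The labels of `s`, changed to `α` and `β` on the circles through the crossing `c`. -/
noncomputable def relabel {c : D.Crossing} {w : D.State} (s : D.EnhancedState)
    (h : Adjacent c s.1 w) (α β : Bool) : D.EnhancedState := by
  classical
  exact ⟨w, Quotient.lift (fun p => if D.curveSetoid (smoothing w) p (bl c) then α else
    if D.curveSetoid (smoothing w) p (tr c) then β else s.2 ⟦p⟧) fun p q hpq => by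
      have h1 (r : D.Point) : D.curveSetoid (smoothing w) p r ↔ D.curveSetoid (smoothing w) q r :=
        ⟨fun h => .trans _ _ _ (.symm _ _ hpq) h, fun h => .trans _ _ _ hpq h⟩
      simp only [h1]
      split_ifs with h2 h3
      · rfl
      · rfl
      · rcases h.symm.rel hpq with h4 | ⟨-, h4⟩
        · exact congrArg s.2 (Quotient.sound h4)
        · exact absurd (h.meets h4) (by unfold Meets; tauto)⟩

section Relabel

variable {c : D.Crossing} {w : D.State} {s : D.EnhancedState} (h : Adjacent c s.1 w)

theorem relabel_bl (α β : Bool) : (relabel s h α β).2 ⟦bl c⟧ = α :=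
  if_pos (.refl _)

theorem relabel_tr (hw : ¬ D.curveSetoid (smoothing w) (bl c) (tr c)) (α β : Bool) :
    (relabel s h α β).2 ⟦tr c⟧ = β :=
  (if_neg fun h => hw (.symm _ _ h)).trans (if_pos (.refl _))

theorem relabel_of_not_meets {p : D.Point} (hp : ¬ Meets w c p) (α β : Bool) :
    (relabel s h α β).2 ⟦p⟧ = s.2 ⟦p⟧ :=
  (if_neg fun h => hp (.inl h)).trans (if_neg fun h => hp (.inr h))

theorem eq_relabel {y : Circle w → Bool}
    (hy : ∀ p, ¬ Meets w c p → s.2 ⟦p⟧ = y ⟦p⟧) :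
    (⟨w, y⟩ : D.EnhancedState) = relabel s h (y ⟦bl c⟧) (y ⟦tr c⟧) := by
  classical
  refine Sigma.ext rfl (heq_of_eq ?_)
  funext C
  induction C using Quotient.inductionOn with
  | h p =>
    by_cases h1 : D.curveSetoid (smoothing w) p (bl c)
    · exact (congrArg y (Quotient.sound h1)).trans (if_pos h1).symm
    by_cases h2 : D.curveSetoid (smoothing w) p (tr c)
    · exact (congrArg y (Quotient.sound h2)).trans ((if_neg h1).trans (if_pos h2)).symm
    have h3 : ¬ Meets w c p := by unfold Meets; tauto
    exact (hy p h3).symm.trans (relabel_of_not_meets h h3 _ _).symm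

theorem mk_ne_mk_iff {v : D.State} {p q : D.Point} :
    (⟦p⟧ : Circle v) ≠ ⟦q⟧ ↔ ¬ D.curveSetoid (smoothing v) p q :=
  not_congr Quotient.eq

theorem saddle_condition_iff {c : D.Crossing} {s t : D.EnhancedState} (h : Adjacent c s.1 t.1) :
    (∀ p : D.Point, (⟦p⟧ : Circle s.1) ≠ ⟦bl c⟧ → (⟦p⟧ : Circle s.1) ≠ ⟦tr c⟧ →
      s.2 ⟦p⟧ = t.2 ⟦p⟧) ↔ ∀ p, ¬ Meets t.1 c p → s.2 ⟦p⟧ = t.2 ⟦p⟧ := by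
  refine forall_congr' fun p => ?_
  rw [← h.meets_iff, mk_ne_mk_iff, mk_ne_mk_iff]
  unfold Meets
  tauto

open Classical in
theorem saddleCoeff_relabel (α β : Bool) :
    saddleCoeff c s (relabel s h α β) =
      if D.curveSetoid (smoothing s.1) (bl c) (tr c) then comulCoeff (s.2 ⟦bl c⟧) α β
      else mulCoeff (s.2 ⟦bl c⟧) (s.2 ⟦tr c⟧) α := by
  unfold saddleCoeff
  have hw := h.rel_bl_tr_iff
  rw [if_pos ((saddle_condition_iff (t := relabel s h α β) h).2 fun p hp =>
      (relabel_of_not_meets h hp α β).symm),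
    relabel_bl]
  by_cases hv : D.curveSetoid (smoothing s.1) (bl c) (tr c)
  · have hw' : ¬ D.curveSetoid (smoothing w) (bl c) (tr c) := fun h' => hw.1 h' hv
    rw [if_pos hv, if_neg (not_not.2 (Quotient.sound hv)), relabel_tr h hw', if_pos]
    exact mk_ne_mk_iff.2 hw'
  · rw [if_neg hv, if_pos (mk_ne_mk_iff.2 hv)]

/-- Cuts the sum over all target states down to the at most four choices of labels at `c`. -/
theorem eq_relabel_of_saddleCoeff_ne_zero {t : D.EnhancedState} (ht : t.1 = w)
    (h0 : saddleCoeff c s t ≠ 0) : ∃ α β, t = relabel s h α β := by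
  obtain ⟨w', y⟩ := t
  obtain rfl : w' = w := ht
  refine ⟨_, _, eq_relabel h ((saddle_condition_iff (t := ⟨w', y⟩) h).1 ?_)⟩
  by_contra hc
  exact h0 (if_neg hc)

variable {f : D.Point → Bool}

/-- Separates the labels at `c` from the condition `DominatedOff`, which is the same for source and
target of the saddle; what remains is a computation in `A`. -/
theorem dominated_relabel_iff (hf : Compat w f) (α β : Bool) :
    Dominated (relabel s h α β) f ↔ (α = true → f (bl c) = true) ∧
      (¬ D.curveSetoid (smoothing w) (bl c) (tr c) → β = true → f (tr c) = true) ∧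
      DominatedOff w c s f := by
  constructor
  · intro hd
    refine ⟨fun h1 => hd _ ((relabel_bl h α β).trans h1),
      fun hw h1 => hd _ ((relabel_tr h hw α β).trans h1),
      fun p hp h1 => hd p ((relabel_of_not_meets h hp α β).trans h1)⟩
  · rintro ⟨h1, h2, h3⟩ p hp
    by_cases h4 : D.curveSetoid (smoothing w) p (bl c)
    · rw [hf _ _ h4]
      replace hp : (relabel s h α β).2 ⟦bl c⟧ = true :=
        (congrArg (relabel s h α β).2 (Quotient.sound h4)).symm.trans hp
      exact h1 ((relabel_bl h α β).symm.trans hp)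
    by_cases h5 : D.curveSetoid (smoothing w) p (tr c)
    · have h6 : ¬ D.curveSetoid (smoothing w) (bl c) (tr c) := fun h6 =>
        h4 (.trans _ _ _ h5 (.symm _ _ h6))
      rw [hf _ _ h5]
      replace hp : (relabel s h α β).2 ⟦tr c⟧ = true :=
        (congrArg (relabel s h α β).2 (Quotient.sound h5)).symm.trans hp
      exact h2 h6 ((relabel_tr h h6 α β).symm.trans hp)
    have h6 : ¬ Meets w c p := by unfold Meets; tauto
    exact h3 p h6 ((relabel_of_not_meets h h6 α β).symm.trans hp)

theorem dominated_iff {c : D.Crossing} {w : D.State} {s : D.EnhancedState}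
    (h : Adjacent c s.1 w) {f : D.Point → Bool} (hf : Compat s.1 f) :
    Dominated s f ↔ (s.2 ⟦bl c⟧ = true → f (bl c) = true) ∧
      (s.2 ⟦tr c⟧ = true → f (tr c) = true) ∧
      DominatedOff w c s f := by
  refine ⟨fun hd => ⟨hd _, hd _, fun p _ => hd p⟩, ?_⟩
  rintro ⟨h1, h2, h3⟩ p hp
  by_cases h4 : Meets w c p
  · rcases h.symm.meets h4 with h5 | h5
    · rw [hf _ _ h5]
      rw [show (⟦p⟧ : Circle s.1) = ⟦bl c⟧ from Quotient.sound h5] at hp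
      exact h1 hp
    · rw [hf _ _ h5]
      rw [show (⟦p⟧ : Circle s.1) = ⟦tr c⟧ from Quotient.sound h5] at hp
      exact h2 hp
  · exact h3 p h4 hp

end Relabel

/-- If `bl c` and `tr c` lie on distinct circles of `v`, the circles of `v` refine those of `w` and
nothing has to be checked. Otherwise `v` merges two circles of `w`, whose labels must agree. -/
theorem Adjacent.compat_iff {c : D.Crossing} {v w : D.State} (h : Adjacent c v w)
    {f : D.Point → Bool} (hf : Compat w f) : Compat v f ↔
      (D.curveSetoid (smoothing v) (bl c) (tr c) → f (bl c) = f (tr c)) := by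
  refine ⟨fun hv => hv _ _, fun hv p q hpq => ?_⟩
  by_cases h1 : D.curveSetoid (smoothing v) (bl c) (tr c)
  · have hm {p : D.Point} (hp : Meets w c p) : f p = f (bl c) :=
      hp.elim (hf _ _) fun hp => (hf _ _ hp).trans (hv h1).symm
    rcases h.rel hpq with h2 | ⟨h2, h3⟩
    · exact hf _ _ h2
    · rw [hm h2, hm h3]
  · exact hf _ _ ((h.rel_iff_of_rel (h.rel_bl_tr_iff.2 h1)).2 (.inl hpq))

open Classical in
/-- The sign by which the saddle at `c` multiplies the idempotent labelling `f`. -/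
noncomputable def saddleSign (v : D.State) (c : D.Crossing) (f : D.Point → Bool) : ℤ :=
  if D.curveSetoid (smoothing v) (bl c) (tr c) ∧ f (bl c) = false then -1 else 1

open Classical in
/-- In the basis of idempotents, saddle maps are diagonal. -/
theorem sum_saddleCoeff {c : D.Crossing} {w : D.State} {s : D.EnhancedState}
    (h : Adjacent c s.1 w) {f : D.Point → Bool} (hf : Compat w f) :
    ∑ t : D.EnhancedState, (if t.1 = w ∧ Dominated t f then saddleCoeff c s t else 0) =
      if Compat s.1 f ∧ Dominated s f then saddleSign s.1 c f else 0 := by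
  have hr (α β : Bool) : (relabel s h α β).1 = w := rfl
  have hcompat := h.compat_iff hf
  have hdom := fun hf => dominated_iff (f := f) h hf
  by_cases hv : D.curveSetoid (smoothing s.1) (bl c) (tr c)
  -- Split: `Δ X = X ⊗ X` and `Δ (1 - X) = -(1 - X) ⊗ (1 - X)`, which is the source of the sign in
  -- `saddleSign`.
  · have hw : ¬ D.curveSetoid (smoothing w) (bl c) (tr c) := fun h' => h.rel_bl_tr_iff.1 h' hv
    have hinj : Function.Injective fun x : Bool × Bool => relabel s h x.1 x.2 := by
      rintro ⟨α, β⟩ ⟨α', β'⟩ he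
      have h1 := relabel_bl h α β
      have h2 := relabel_tr h hw α β
      simp only at he
      rw [he] at h1 h2
      rw [← h1, ← h2, relabel_bl, relabel_tr h hw]
    rw [← Fintype.sum_of_injective _ hinj (fun x : Bool × Bool =>
      if Dominated (relabel s h x.1 x.2) f then comulCoeff (s.2 ⟦bl c⟧) x.1 x.2 else 0) _ ?_ ?_]
    · have hst : s.2 ⟦tr c⟧ = s.2 ⟦bl c⟧ := congrArg s.2 (Quotient.sound (.symm _ _ hv))
      simp only [dominated_relabel_iff h hf, hw, not_false_iff, true_imp_iff]
      simp only [hv, true_imp_iff] at hcompat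
      rw [hst] at hdom
      unfold saddleSign
      by_cases hrest : DominatedOff w c s f
      · by_cases hfe : f (bl c) = f (tr c)
        · rw [hdom (hcompat.2 hfe)]
          simp only [hcompat, hrest, hv, ← hfe, and_true, true_and, Fintype.sum_prod_type,
            Fintype.sum_bool]
          cases s.2 ⟦bl c⟧ <;> cases f (bl c) <;> simp [comulCoeff]
        · simp only [hcompat, hrest, hfe, false_and, if_false, and_true, Fintype.sum_prod_type,
            Fintype.sum_bool]
          cases s.2 ⟦bl c⟧ <;> cases hb : f (bl c) <;> cases ht : f (tr c) <;>
            simp [comulCoeff] <;> simp_all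
      · rw [if_neg]
        · simp [hrest]
        · rintro ⟨h1, h2⟩
          exact hrest ((hdom h1).1 h2).2.2
    · intro t ht
      by_contra h0
      have h1 : t.1 = w := by
        by_contra h1
        exact h0 (if_neg fun h2 => h1 h2.1)
      obtain ⟨α, β, rfl⟩ := eq_relabel_of_saddleCoeff_ne_zero h h1 fun h2 => h0 (by
        rw [h2, ite_self])
      exact ht ⟨(α, β), rfl⟩
    · rintro ⟨α, β⟩
      simp only [hr, true_and, saddleCoeff_relabel, hv, if_true]
  -- Merge: `X` and `1 - X` are orthogonal idempotents, so there is no sign. Only one circle of `w`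
  -- meets `c`, hence the second label of `relabel` is void.
  · have hw : D.curveSetoid (smoothing w) (bl c) (tr c) := h.rel_bl_tr_iff.2 hv
    have heq (α β : Bool) : relabel s h α β = relabel s h α α := by
      have h1 := eq_relabel h (y := (relabel s h α β).2) fun p hp =>
        (relabel_of_not_meets h hp α β).symm
      have h2 : (relabel s h α β).2 ⟦tr c⟧ = (relabel s h α β).2 ⟦bl c⟧ :=
        congrArg (relabel s h α β).2 (Quotient.sound (.symm _ _ hw))
      exact h1.trans (congrArg₂ (relabel s h) (relabel_bl h α β) (h2.trans (relabel_bl h α β)))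
    have hinj : Function.Injective fun α : Bool => relabel s h α α := by
      intro α α' he
      have h1 := relabel_bl h α α
      simp only at he
      rw [he, relabel_bl] at h1
      exact h1.symm
    rw [← Fintype.sum_of_injective _ hinj (fun α : Bool =>
      if Dominated (relabel s h α α) f then mulCoeff (s.2 ⟦bl c⟧) (s.2 ⟦tr c⟧) α else 0) _ ?_ ?_]
    · have hfe : f (bl c) = f (tr c) := hf _ _ hw
      have hs : Compat s.1 f := hcompat.2 fun h' => absurd h' hv
      simp only [dominated_relabel_iff h hf, hw, not_true, false_imp_iff, true_and, hs,
        hdom hs, saddleSign, hv, false_and, if_false, ← hfe, Fintype.sum_bool]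
      by_cases hrest : DominatedOff w c s f
      · simp only [hrest, and_true]
        cases s.2 ⟦bl c⟧ <;> cases s.2 ⟦tr c⟧ <;> cases f (bl c) <;> simp [mulCoeff]
      · simp [hrest]
    · intro t ht
      by_contra h0
      have h1 : t.1 = w := by
        by_contra h1
        exact h0 (if_neg fun h2 => h1 h2.1)
      obtain ⟨α, β, rfl⟩ := eq_relabel_of_saddleCoeff_ne_zero h h1 fun h2 => h0 (by
        rw [h2, ite_self])
      exact ht ⟨α, (heq α β).symm⟩
    · intro α
      simp only [hr, true_and, saddleCoeff_relabel, hv, if_false]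

end LinkDiagram

/-! ### Signs around the squares of the cube -/

namespace LinkDiagram

variable {D : LinkDiagram}

section Signs

theorem update_eq_of_apply_eq {v : D.State} {c : D.Crossing} {b : Bool} (h : v c = b) :
    Function.update v c b = v := by
  subst h
  exact Function.update_eq_self c v

open Classical in
/-- The sign of an edge of the cube of smoothings. -/
noncomputable def cubeSign (v : D.State) (c : D.Crossing) : ℤ :=
  (-1) ^ (Finset.univ.filter fun c' : D.Crossing => c' < c ∧ v c' = true).card

/-- The coefficient by which the differential multiplies the idempotent labelling `f` along the edge
of the cube of smoothings that starts at `v` and changes `c`. -/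
noncomputable def edgeSign (v : D.State) (c : D.Crossing) (f : D.Point → Bool) : ℤ :=
  cubeSign v c * saddleSign v c f

theorem cubeSign_mul_self (v : D.State) (c : D.Crossing) : cubeSign v c * cubeSign v c = 1 := by
  unfold cubeSign
  rw [← mul_pow]
  simp

theorem edgeSign_mul_self (v : D.State) (c : D.Crossing) (f : D.Point → Bool) :
    edgeSign v c f * edgeSign v c f = 1 := by
  have h1 := cubeSign_mul_self v c
  have h2 : saddleSign v c f * saddleSign v c f = 1 := by
    unfold saddleSign
    split_ifs <;> norm_num
  calc edgeSign v c f * edgeSign v c f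
      = (cubeSign v c * cubeSign v c) * (saddleSign v c f * saddleSign v c f) := by
        unfold edgeSign; ring
    _ = 1 := by rw [h1, h2, one_mul]

theorem cubeSign_update_of_lt {v : D.State} {c c' : D.Crossing} (hc : v c = false) (h : c < c') :
    cubeSign (Function.update v c true) c' = -cubeSign v c' := by
  classical
  unfold cubeSign
  have h1 : (Finset.univ.filter fun b : D.Crossing =>
      b < c' ∧ Function.update v c true b = true) =
      insert c (Finset.univ.filter fun b : D.Crossing => b < c' ∧ v b = true) := by
    ext b
    rcases eq_or_ne b c with rfl | hb
    · simp [h]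
    · simp [hb]
  rw [h1, Finset.card_insert_of_notMem (by simp [hc]), pow_succ]
  ring

theorem cubeSign_update_of_not_lt {v : D.State} {c c' : D.Crossing} (h : ¬ c < c') :
    cubeSign (Function.update v c true) c' = cubeSign v c' := by
  classical
  unfold cubeSign
  congr 2
  ext b
  rcases eq_or_ne b c with rfl | hb
  · simp [h]
  · simp [Function.update_of_ne hb]

theorem cubeSign_anticomm {v : D.State} {c c' : D.Crossing} (hne : c ≠ c') (hc : v c = false)
    (hc' : v c' = false) :
    cubeSign v c * cubeSign (Function.update v c true) c' =
      -(cubeSign v c' * cubeSign (Function.update v c' true) c) := by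
  rcases lt_or_gt_of_ne hne with h | h
  · rw [cubeSign_update_of_lt hc h, cubeSign_update_of_not_lt h.not_gt]
    ring
  · rw [cubeSign_update_of_lt hc' h, cubeSign_update_of_not_lt h.not_gt]
    ring

theorem Adjacent.apply_bl_eq {c : D.Crossing} {v w : D.State} (h : Adjacent c v w)
    {f : D.Point → Bool} (hv : Compat v f) (hw : Compat w f) : f (bl c) = f (tr c) := by
  by_cases h1 : D.curveSetoid (smoothing v) (bl c) (tr c)
  · exact hv _ _ h1
  · exact hw _ _ (h.rel_bl_tr_iff.2 h1)

theorem Adjacent.compat {c : D.Crossing} {v w : D.State} (h : Adjacent c v w)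
    {f : D.Point → Bool} (hv : Compat v f) (hf : f (bl c) = f (tr c)) : Compat w f :=
  (h.symm.compat_iff hv).2 fun _ => hf

/-- The labels show that the circle through `c` is disjoint from those through `c'`, so the saddle
at `c'` leaves it alone. -/
theorem Adjacent.rel_of_apply_ne {c c' : D.Crossing} {v w : D.State} (h : Adjacent c' v w)
    {f : D.Point → Bool} (hv : Compat v f) (hw : Compat w f) (hne : f (bl c) ≠ f (bl c'))
    (hr : D.curveSetoid (smoothing v) (bl c) (tr c)) :
    D.curveSetoid (smoothing w) (bl c) (tr c) := by
  rcases h.rel hr with h1 | ⟨h1, -⟩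
  · exact h1
  · rcases h1 with h1 | h1
    · exact absurd (hw _ _ h1) hne
    · exact absurd ((hw _ _ h1).trans (h.apply_bl_eq hv hw).symm) hne

/-- Only splits of circles labelled `1 - X` carry a sign. If both crossings have that label, the two
paths contain equally many splits, because each has two saddles and the same total change in the
number of circles. If the labels differ, the two saddles concern disjoint circles and do not
influence each other. -/
theorem saddleSign_comm {c c' : D.Crossing} {v₀₀ v₁₀ v₀₁ v₁₁ : D.State}
    (h₁ : Adjacent c v₀₀ v₁₀) (h₂ : Adjacent c' v₁₀ v₁₁) (h₃ : Adjacent c' v₀₀ v₀₁)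
    (h₄ : Adjacent c v₀₁ v₁₁) {f : D.Point → Bool} (hf₀₀ : Compat v₀₀ f) (hf₁₀ : Compat v₁₀ f)
    (hf₀₁ : Compat v₀₁ f) :
    saddleSign v₀₀ c f * saddleSign v₁₀ c' f = saddleSign v₀₀ c' f * saddleSign v₀₁ c f := by
  classical
  unfold saddleSign
  cases hc : f (bl c) <;> cases hc' : f (bl c')
  · have key {c : D.Crossing} {v w : D.State} (h : Adjacent c v w) :
        D.curveSetoid (smoothing v) (bl c) (tr c) ∧
          Nat.card (Circle w) = Nat.card (Circle v) + 1 ∨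
        ¬ D.curveSetoid (smoothing v) (bl c) (tr c) ∧
          Nat.card (Circle v) = Nat.card (Circle w) + 1 := by
      by_cases hr : D.curveSetoid (smoothing v) (bl c) (tr c)
      · exact .inl ⟨hr, h.symm.card_circle hr⟩
      · exact .inr ⟨hr, h.card_circle (h.rel_bl_tr_iff.2 hr)⟩
    rcases key h₁ with ⟨r₁, n₁⟩ | ⟨r₁, n₁⟩ <;> rcases key h₂ with ⟨r₂, n₂⟩ | ⟨r₂, n₂⟩ <;>
      rcases key h₃ with ⟨r₃, n₃⟩ | ⟨r₃, n₃⟩ <;> rcases key h₄ with ⟨r₄, n₄⟩ | ⟨r₄, n₄⟩ <;>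
      first
      | exfalso; omega
      | simp [r₁, r₂, r₃, r₄]
  · have hne : f (bl c) ≠ f (bl c') := by simp [hc, hc']
    have hr : D.curveSetoid (smoothing v₀₀) (bl c) (tr c) ↔
        D.curveSetoid (smoothing v₀₁) (bl c) (tr c) :=
      ⟨h₃.rel_of_apply_ne hf₀₀ hf₀₁ hne, h₃.symm.rel_of_apply_ne hf₀₁ hf₀₀ hne⟩
    simp only [Bool.true_eq_false, and_false, if_false, one_mul, mul_one]
    exact if_congr (and_congr_left' hr) rfl rfl
  · have hne : f (bl c') ≠ f (bl c) := by simp [hc, hc']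
    have hr : D.curveSetoid (smoothing v₀₀) (bl c') (tr c') ↔
        D.curveSetoid (smoothing v₁₀) (bl c') (tr c') :=
      ⟨h₁.rel_of_apply_ne hf₀₀ hf₁₀ hne, h₁.symm.rel_of_apply_ne hf₁₀ hf₀₀ hne⟩
    simp only [Bool.true_eq_false, and_false, if_false, one_mul, mul_one]
    exact if_congr (and_congr_left' hr.symm) rfl rfl
  · simp

theorem edgeSign_anticomm {v : D.State} {c c' : D.Crossing} (hne : c ≠ c') (hc : v c = false)
    (hc' : v c' = false) {f : D.Point → Bool} (hv : Compat v f)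
    (hfc : f (bl c) = f (tr c)) (hfc' : f (bl c') = f (tr c')) :
    edgeSign v c f * edgeSign (Function.update v c true) c' f =
      -(edgeSign v c' f * edgeSign (Function.update v c' true) c f) := by
  have h₁ : Adjacent c v (Function.update v c true) := adjacent_update (by simp [hc])
  have h₂ : Adjacent c' (Function.update v c true)
      (Function.update (Function.update v c true) c' true) :=
    adjacent_update (by simp [Function.update_of_ne hne.symm, hc'])
  have h₃ : Adjacent c' v (Function.update v c' true) := adjacent_update (by simp [hc'])
  have h₄ : Adjacent c (Function.update v c' true)
      (Function.update (Function.update v c true) c' true) := by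
    rw [Function.update_comm hne]
    exact adjacent_update (by simp [Function.update_of_ne hne, hc])
  have hs := saddleSign_comm h₁ h₂ h₃ h₄ hv (h₁.compat hv hfc) (h₃.compat hv hfc')
  have ht := cubeSign_anticomm hne hc hc'
  unfold edgeSign
  linear_combination (saddleSign v c f * saddleSign (Function.update v c true) c' f) * ht -
    (cubeSign v c' * cubeSign (Function.update v c' true) c) * hs

end Signs

/-! ### The complex in idempotent coordinates -/

variable (F : Type*) [Field F]

open Classical in
/-- The coefficient of a cochain at the labelling `f` of the circles of `v` by the two primitive
idempotents of `F[X]/(X² - X)`. -/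
noncomputable def evalAt (v : D.State) (f : D.Point → Bool) : D.Cochain F →ₗ[F] F where
  toFun x := ∑ s, if s.1 = v ∧ Dominated s f then x s else 0
  map_add' x y := by
    rw [← Finset.sum_add_distrib]
    refine Finset.sum_congr rfl fun s _ => ?_
    split_ifs <;> simp
  map_smul' a x := by
    rw [RingHom.id_apply, smul_eq_mul, Finset.mul_sum]
    refine Finset.sum_congr rfl fun s _ => ?_
    split_ifs <;> simp

open Classical in
theorem evalAt_apply (v : D.State) (f : D.Point → Bool) (x : D.Cochain F) :
    evalAt F v f x = ∑ s, if s.1 = v ∧ Dominated s f then x s else 0 := rfl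

/-- The change of coordinates is unitriangular: at the labelling given by `y`, only labels below `y`
contribute, and `y` itself contributes with coefficient 1. -/
theorem eq_zero_of_evalAt {x : D.Cochain F}
    (h : ∀ v f, Compat v f → evalAt F v f x = 0) : x = 0 := by
  classical
  funext ⟨v, y⟩
  induction y using WellFoundedLT.induction with
  | _ y ih =>
    have h1 := h v (fun p => y ⟦p⟧) fun p q hpq => congrArg y (Quotient.sound hpq)
    rw [evalAt_apply, Finset.sum_eq_single ⟨v, y⟩] at h1
    · rw [if_pos ⟨rfl, fun p hp => hp⟩] at h1
      exact h1
    · rintro ⟨w, z⟩ - hne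
      split_ifs with hd
      · obtain ⟨rfl, hd⟩ : w = v ∧ _ := hd
        refine ih z (lt_of_le_of_ne ?_ fun he => hne (he ▸ rfl))
        intro C
        induction C using Quotient.inductionOn with
        | h p => exact Bool.le_iff_imp.2 (hd p)
      · rfl
    · intro h2
      exact absurd (Finset.mem_univ _) h2

/-- Labellings compatible with `v` are the same as functions on its circles, so evaluation gives an
endomorphism of a finite-dimensional space; being injective, it is surjective. -/
theorem exists_evalAt_eq (g : D.State → (D.Point → Bool) → F) :
    ∃ x : D.Cochain F, ∀ v f, Compat v f → evalAt F v f x = g v f := by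
  let Φ : D.Cochain F →ₗ[F] D.Cochain F :=
    LinearMap.pi fun s => evalAt F s.1 fun p => s.2 (⟦p⟧ : Circle s.1)
  have hinj : Function.Injective Φ := by
    refine (injective_iff_map_eq_zero Φ).2 fun x hx => eq_zero_of_evalAt F fun v f hf => ?_
    exact congrFun hx ⟨v, Quotient.lift f hf⟩
  obtain ⟨x, hx⟩ := LinearMap.injective_iff_surjective.1 hinj
    fun s => g s.1 fun p => s.2 (⟦p⟧ : Circle s.1)
  exact ⟨x, fun v f hf => congrFun hx ⟨v, Quotient.lift f hf⟩⟩

open Classical in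
theorem sum_dCoeff (s : D.EnhancedState) {w : D.State} {f : D.Point → Bool} (hf : Compat w f) :
    ∑ t : D.EnhancedState, (if t.1 = w ∧ Dominated t f then dCoeff s t else 0) =
      ∑ c, if w c = true ∧ Compat (Function.update w c false) f then
        (if s.1 = Function.update w c false ∧ Dominated s f then
          edgeSign (Function.update w c false) c f else 0) else 0 := by
  have h1 (t : D.EnhancedState) : (if t.1 = w ∧ Dominated t f then dCoeff s t else 0) =
      ∑ c, if s.1 c = false ∧ w = Function.update s.1 c true then
        cubeSign s.1 c * (if t.1 = w ∧ Dominated t f then saddleCoeff c s t else 0) else 0 := by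
    unfold dCoeff cubeSign
    split_ifs with h
    · rw [h.1]
    · simp
  simp only [h1]
  rw [Finset.sum_comm]
  refine Finset.sum_congr rfl fun c _ => ?_
  by_cases hc : s.1 c = false ∧ w = Function.update s.1 c true
  · have hs : s.1 = Function.update w c false := by
      rw [hc.2, Function.update_idem, update_eq_of_apply_eq hc.1]
    have hw : w c = true := by rw [hc.2, Function.update_self]
    have hadj : Adjacent c s.1 w := by
      rw [hc.2]
      exact adjacent_update (by simp [hc.1])
    simp only [if_pos hc, ← Finset.mul_sum]
    rw [sum_saddleCoeff hadj hf]
    simp only [hw, ← hs, true_and]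
    unfold edgeSign
    split_ifs <;> first | rfl | tauto | simp
  · simp only [if_neg hc, Finset.sum_const_zero]
    symm
    split_ifs with h2 h3
    · refine absurd ⟨?_, ?_⟩ hc
      · rw [h3.1, Function.update_self]
      · rw [h3.1, Function.update_idem, update_eq_of_apply_eq h2.1]
    · rfl
    · rfl

open Classical in
-- Different labellings never mix. The summand of `f` is a signed cube of one-dimensional spaces,
-- whose directions are the crossings with constant label.
theorem evalAt_d {w : D.State} {f : D.Point → Bool} (hf : Compat w f) (x : D.Cochain F) :
    evalAt F w f (d F x) = ∑ c, if w c = true ∧ Compat (Function.update w c false) f then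
      (edgeSign (Function.update w c false) c f : F) *
        evalAt F (Function.update w c false) f x else 0 := by
  have h1 (t : D.EnhancedState) : (if t.1 = w ∧ Dominated t f then d F x t else 0) =
      ∑ s, ((if t.1 = w ∧ Dominated t f then dCoeff s t else 0 : ℤ) : F) * x s := by
    split_ifs
    · rfl
    · simp
  rw [evalAt_apply]
  simp only [h1]
  rw [Finset.sum_comm]
  simp only [← Finset.sum_mul, ← Int.cast_sum, sum_dCoeff _ hf]
  simp only [Int.cast_sum, Finset.sum_mul]
  rw [Finset.sum_comm]
  refine Finset.sum_congr rfl fun c _ => ?_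
  split_ifs
  · rw [evalAt_apply, Finset.mul_sum]
    refine Finset.sum_congr rfl fun s _ => ?_
    split_ifs <;> simp
  · simp

/-- A labelling without crossings of constant label contributes nothing to the coboundaries. -/
theorem evalAt_d_eq_zero {w : D.State} {f : D.Point → Bool} (hf : Compat w f)
    (hne : ∀ c : D.Crossing, f (bl c) ≠ f (tr c)) (x : D.Cochain F) : evalAt F w f (d F x) = 0 := by
  rw [evalAt_d F hf]
  refine Finset.sum_eq_zero fun c _ => if_neg fun h => hne c ?_
  exact (adjacent_update (v := w) (c := c) (b := false) (by simp [h.1])).apply_bl_eq hf h.2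

/-- The part of the complex given by labellings with a crossing of constant label is acyclic. -/
theorem exists_evalAt_d_eq {x : D.Cochain F} (hx : d F x = 0) :
    ∃ y : D.Cochain F, ∀ w f, Compat w f → (∃ c : D.Crossing, f (bl c) = f (tr c)) →
      evalAt F w f (d F y) = evalAt F w f x := by
  classical
  -- Contracting homotopy: go back along the edge at one crossing of constant label. The crossing is
  -- chosen from `f` alone, hence is the same for all states.
  obtain ⟨y, hy⟩ := exists_evalAt_eq F (D := D) fun v f =>
    if h : ∃ c : D.Crossing, f (bl c) = f (tr c) then
      if v h.choose = false then
        (edgeSign v h.choose f : F) * evalAt F (Function.update v h.choose true) f x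
      else 0
    else 0
  refine ⟨y, fun w f hf hex => ?_⟩
  have hy' : ∀ v, Compat v f → evalAt F v f y = if v hex.choose = false then
      (edgeSign v hex.choose f : F) * evalAt F (Function.update v hex.choose true) f x
      else 0 := fun v hv => by
    rw [hy v f hv, dif_pos hex]
  have hfc := hex.choose_spec
  generalize hex.choose = c₀ at hfc hy'
  rw [evalAt_d F hf]
  cases hw : w c₀
  · have hadj : Adjacent c₀ w (Function.update w c₀ true) := adjacent_update (by simp [hw])
    have h0 := evalAt_d F (hadj.compat hf hfc) x
    rw [hx, map_zero] at h0
    have hsq : (edgeSign w c₀ f : F) * edgeSign w c₀ f = 1 := by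
      exact_mod_cast congrArg (Int.cast : ℤ → F) (edgeSign_mul_self w c₀ f)
    -- By anticommutativity, each term of `d y` at `w` is a fixed sign times a term of `d x` at `w`
    -- with `c₀` switched on, apart from the term of `c₀`, which accounts for `x` itself. The former
    -- sum to zero because `x` is a cocycle.
    have key : ∀ c, (if w c = true ∧ Compat (Function.update w c false) f then
        (edgeSign (Function.update w c false) c f : F) *
          evalAt F (Function.update w c false) f y else 0) =
        -(edgeSign w c₀ f : F) * (if Function.update w c₀ true c = true ∧
          Compat (Function.update (Function.update w c₀ true) c false) f then
          (edgeSign (Function.update (Function.update w c₀ true) c false) c f : F) *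
            evalAt F (Function.update (Function.update w c₀ true) c false) f x else 0) +
        if c = c₀ then evalAt F w f x else 0 := by
      intro c
      rcases eq_or_ne c c₀ with rfl | hc
      · have h1 : Function.update w c false = w := update_eq_of_apply_eq hw
        simp only [hw, Function.update_self, Function.update_idem, h1, hf, if_true, true_and,
          Bool.false_eq_true, false_and, if_false]
        linear_combination evalAt F w f x * hsq
      · rw [if_neg hc, add_zero, Function.update_of_ne hc, Function.update_comm hc.symm]
        have hv0 : Function.update w c false c₀ = false := by rw [Function.update_of_ne hc.symm, hw]
        have hadj' : Adjacent c₀ (Function.update w c false)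
          (Function.update (Function.update w c false) c₀ true) := adjacent_update (by simp [hv0])
        by_cases h2 : w c = true ∧ Compat (Function.update w c false) f
        · rw [if_pos h2, if_pos ⟨h2.1, hadj'.compat h2.2 hfc⟩, hy' _ h2.2, if_pos hv0]
          have h3 : Function.update (Function.update w c false) c true = w := by
            rw [Function.update_idem, update_eq_of_apply_eq h2.1]
          have hfc' : f (bl c) = f (tr c) :=
            (adjacent_update (v := w) (c := c) (b := false) (by simp [h2.1])).apply_bl_eq hf h2.2
          have h4 := edgeSign_anticomm hc (Function.update_self ..) hv0 h2.2 hfc' hfc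
          rw [h3] at h4
          have h4' := congrArg (Int.cast : ℤ → F) h4
          have h5 : (edgeSign (Function.update w c false) c₀ f : F) *
              edgeSign (Function.update w c false) c₀ f = 1 := by
            exact_mod_cast congrArg (Int.cast : ℤ → F) (edgeSign_mul_self _ c₀ f)
          push_cast at h4'
          generalize (edgeSign (Function.update w c false) c₀ f : F) = a at *
          generalize (edgeSign (Function.update w c false) c f : F) = b at *
          generalize (edgeSign w c₀ f : F) = e at *
          generalize (edgeSign (Function.update (Function.update w c false) c₀ true) c f : F) = g
            at *
          generalize evalAt F (Function.update (Function.update w c false) c₀ true) f x = z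
          linear_combination (e * a * z) * h4' - (a * b * z) * hsq - (e * g * z) * h5
        · rw [if_neg h2, if_neg fun h3 => h2 ⟨h3.1, hadj'.symm.compat h3.2 hfc⟩, mul_zero]
    rw [Finset.sum_congr rfl fun c _ => key c, Finset.sum_add_distrib, ← Finset.mul_sum, ← h0,
      mul_zero, zero_add, Finset.sum_ite_eq' Finset.univ c₀, if_pos (Finset.mem_univ _)]
  -- Here only the edge at `c₀` contributes, since `y` vanishes at states with `c₀` switched on.
  · have hadj : Adjacent c₀ w (Function.update w c₀ false) := adjacent_update (by simp [hw])
    rw [Finset.sum_eq_single c₀]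
    · rw [if_pos ⟨hw, hadj.compat hf hfc⟩, hy' _ (hadj.compat hf hfc),
        if_pos (Function.update_self ..), ← mul_assoc, Function.update_idem,
        update_eq_of_apply_eq hw]
      have h1 := congrArg (Int.cast : ℤ → F) (edgeSign_mul_self (Function.update w c₀ false) c₀ f)
      push_cast at h1
      rw [h1, one_mul]
    · intro c _ hc
      split_ifs with h2
      · rw [hy' _ h2.2, if_neg, mul_zero]
        rw [Function.update_of_ne hc.symm, hw]
        simp
      · rfl
    · intro h2
      exact absurd (Finset.mem_univ _) h2

end LinkDiagram

/-! ### Orientations, canonical cocycles and a spanning set of homology -/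

namespace LinkDiagram

variable {D : LinkDiagram}

theorem compat_whiteOnRight (o : D.Orientation) : Compat (orientedState o) (whiteOnRight o) :=
  compat_of_arc fun _ _ => whiteOnRight_eq_of_arc o

/-- The strand from `bl c` to `tr c` crosses the other strand, and with it the colour on its right
changes. -/
theorem whiteOnRight_bl_ne (o : D.Orientation) (c : D.Crossing) :
    whiteOnRight o (bl c) ≠ whiteOnRight o (tr c) := by
  have h := up_bl_eq o c (q := tr c) ⟨rfl, rfl⟩
  unfold whiteOnRight
  rw [← h]
  simp only [bl, tr, Nat.even_iff]
  by_cases hp : D.pos c.1 % 2 = 0 <;> split_ifs <;> simp <;> omega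

/-- Inverts `whiteOnRight`; this formula is how a labelling is turned back into an orientation. -/
theorem up_eq (o : D.Orientation) (p : D.Point) :
    o.up p = (whiteOnRight o p == decide (¬ Even (p.2 : ℕ))) := by
  unfold whiteOnRight
  by_cases h : Even (p.2 : ℕ) <;> cases o.up p <;> simp [h, Nat.even_add_one]

theorem orientation_ext {o o' : D.Orientation} (h : o.up = o'.up) : o = o' := by
  cases o
  cases o'
  congr

theorem whiteOnRight_injective :
    Function.Injective (whiteOnRight : D.Orientation → D.Point → Bool) := by
  intro o o' h
  exact orientation_ext (funext fun p => by rw [up_eq, up_eq, h])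

instance : Finite D.Orientation :=
  Finite.of_injective (fun o : D.Orientation => o.up) fun _ _ h => orientation_ext h

noncomputable instance : Fintype D.Orientation := Fintype.ofFinite _

theorem smoothing_eq_horizontal {v : D.State} {c : D.Crossing} :
    smoothing v c = CrossingMode.horizontal ↔ (D.kind c.1).blOver = v c := by
  unfold smoothing
  split_ifs with h <;> simp [h]

/-- A labelling of the circles of a smoothing that is constant at no crossing comes from an
orientation. -/
theorem exists_orientation {v : D.State} {f : D.Point → Bool} (hf : Compat v f)
    (hne : ∀ c : D.Crossing, f (bl c) ≠ f (tr c)) :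
    ∃ o : D.Orientation, orientedState o = v ∧ whiteOnRight o = f := by
  classical
  have harc {p q : D.Point} (h : D.Arc (smoothing v) p q) : f p = f q := hf _ _ (.rel _ _ h)
  -- The orientation is forced by `up_eq`. Its compatibility is checked for the three types of arcs
  -- of the link: between lines with equal parity, turns, and strands through a crossing, along
  -- which `f` changes.
  have hdiff {p q : D.Point} (h1 : f p = f q) (h2 : p.1 ≠ q.1) (h3 : (p.2 + q.2 : ℕ) % 2 = 0) :
      (f p == decide (¬ Even (p.2 : ℕ))) = (f q == decide (¬ Even (q.2 : ℕ))) ↔ p.1 ≠ q.1 := by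
    have h4 : Even (p.2 : ℕ) ↔ Even (q.2 : ℕ) := by simp only [Nat.even_iff]; omega
    simp [h1, h2, h4]
  have hsame {p q : D.Point} (h1 : f p = f q) (h2 : p.1 = q.1) (h3 : (p.2 + q.2 : ℕ) % 2 = 1) :
      (f p == decide (¬ Even (p.2 : ℕ))) = (f q == decide (¬ Even (q.2 : ℕ))) ↔ p.1 ≠ q.1 := by
    have h4 : Even (p.2 : ℕ) ↔ ¬ Even (q.2 : ℕ) := by simp only [Nat.even_iff]; omega
    simp only [h1, h4]
    by_cases h5 : Even (q.2 : ℕ) <;> cases f q <;> simp [h5, h2]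
  have hcross {p q : D.Point} (h1 : f p ≠ f q) (h2 : p.1 ≠ q.1) (h3 : (p.2 + q.2 : ℕ) % 2 = 1) :
      (f p == decide (¬ Even (p.2 : ℕ))) = (f q == decide (¬ Even (q.2 : ℕ))) ↔ p.1 ≠ q.1 := by
    have h4 : Even (p.2 : ℕ) ↔ ¬ Even (q.2 : ℕ) := by simp only [Nat.even_iff]; omega
    simp only [h4]
    by_cases h5 : Even (q.2 : ℕ) <;> cases h6 : f q <;> cases h7 : f p <;> simp_all
  have ne {p q : D.Point} {k : ℕ} (h1 : (p.1 : ℕ) = k) (h2 : (q.1 : ℕ) = k + 1) : p.1 ≠ q.1 :=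
    fun h => by have := congrArg Fin.val h; omega
  have eq {p q : D.Point} {k : ℕ} (h1 : (p.1 : ℕ) = k) (h2 : (q.1 : ℕ) = k) : p.1 = q.1 :=
    Fin.ext (h1.trans h2.symm)
  -- The four endpoints are paired by the smoothing, and the two pairs have different labels; so `f`
  -- determines the smoothing.
  have hbl (c : D.Crossing) : f (bl c) = f (br c) ↔
      smoothing v c = CrossingMode.horizontal := by
    have h1 := hf _ _ (above_bl (v := v) (c := c)).rel
    have h2 := hf _ _ (below_tr (v := v) (c := c)).rel
    have h3 := hne c
    split_ifs at h1 h2 with h4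
    · simp [h1, h4]
    · rw [← h2]
      simp [h3, h4]
  have hbr (c : D.Crossing) : f (br c) ≠ f (tl c) := by
    have h1 := hf _ _ (above_bl (v := v) (c := c)).rel
    have h2 := hf _ _ (below_tr (v := v) (c := c)).rel
    have h3 := hne c
    split_ifs at h1 h2 with h4
    · rw [← h1, ← h2]
      exact h3
    · rw [← h1, ← h2]
      exact h3.symm
  have hcompat : ∀ p q : D.Point, D.Arc (fun _ => CrossingMode.through) p q →
      ((f p == decide (¬ Even (p.2 : ℕ))) = (f q == decide (¬ Even (q.2 : ℕ))) ↔ p.1 ≠ q.1) := by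
    intro p q h
    cases h with
    | left k j p q hj hp hq =>
      exact hdiff (harc (.left k j p q hj hp hq)) (ne hp.1 hq.1) (by rw [hp.2, hq.2]; omega)
    | right_of_cup k j p q hk hj hp hq =>
      exact hdiff (harc (.right_of_cup k j p q hk hj hp hq)) (ne hp.1 hq.1)
        (by rw [hp.2, hq.2]; omega)
    | right_of_cap k j p q hk hj hp hq =>
      exact hdiff (harc (.right_of_cap k j p q hk hj hp hq)) (ne hp.1 hq.1)
        (by rw [hp.2, hq.2]; omega)
    | right_of_cross c j p q hj hp hq =>
      exact hdiff (harc (.right_of_cross c j p q hj hp hq)) (ne hp.1 hq.1)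
        (by rw [hp.2, hq.2]; omega)
    | cup k p q hk hp hq =>
      exact hsame (harc (.cup k p q hk hp hq)) (eq hp.1 hq.1) (by rw [hp.2, hq.2]; omega)
    | cap k p q hk hp hq =>
      exact hsame (harc (.cap k p q hk hp hq)) (eq hp.1 hq.1) (by rw [hp.2, hq.2]; omega)
    | through₁ c p q hm hp hq =>
      refine hcross ?_ (ne hp.1 hq.1) (by rw [hp.2, hq.2]; omega)
      obtain rfl : p = bl c := at_unique hp ⟨rfl, rfl⟩
      obtain rfl : q = tr c := at_unique hq ⟨rfl, rfl⟩
      exact hne c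
    | through₂ c p q hm hp hq =>
      refine hcross ?_ (ne hp.1 hq.1) (by rw [hp.2, hq.2]; omega)
      obtain rfl : p = br c := at_unique hp ⟨rfl, rfl⟩
      obtain rfl : q = tl c := at_unique hq ⟨rfl, rfl⟩
      exact hbr c
    | vertical₁ c p q hm => cases hm
    | vertical₂ c p q hm => cases hm
    | horizontal₁ c p q hm => cases hm
    | horizontal₂ c p q hm => cases hm
  refine ⟨⟨fun p => f p == decide (¬ Even (p.2 : ℕ)), hcompat⟩, ?_, ?_⟩
  · funext c
    have h1 := (hbl c).trans smoothing_eq_horizontal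
    have h2 : decide (¬ Even ((br c).2 : ℕ)) = !decide (¬ Even ((bl c).2 : ℕ)) := by
      by_cases h : Even (D.pos c.1) <;> simp [bl, br, Nat.even_add_one, -Nat.not_even_iff_odd, h]
    have h3 : ∀ a b e k w : Bool, (a = b ↔ k = w) → (k != ((a == e) == (b == !e))) = w := by
      decide
    unfold orientedState
    simp only [h2]
    exact h3 _ _ _ _ _ h1
  · funext p
    unfold whiteOnRight
    by_cases h3 : Even (p.2 : ℕ) <;> cases h4 : f p <;> simp [h3, h4, Nat.even_add_one]

variable (F : Type*) [Field F]

theorem sum_idempotentCoeff (w l : Bool) :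
    ∑ b : Bool, (if b = true → l = true then (idempotentCoeff w b : F) else 0) =
      if w = l then 1 else 0 := by
  cases w <;> cases l <;> simp [idempotentCoeff]

open Classical in
-- Coordinates of a tensor product are products of coordinates, and each `I_C` is itself one of the
-- two idempotents. So the canonical cocycle is a vector of the idempotent basis.
theorem evalAt_canonicalCocycle (o : D.Orientation) {v : D.State} {f : D.Point → Bool}
    (hf : Compat v f) : evalAt F v f (canonicalCocycle F o) =
      if v = orientedState o ∧ f = whiteOnRight o then 1 else 0 := by
  rw [evalAt_apply]
  by_cases hv : v = orientedState o
  · have : Finite (Circle v) := Quotient.finite _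
    let _ : Fintype (Circle v) := Fintype.ofFinite _
    let l : Circle v → Bool := Quotient.lift f hf
    have hterm (y : Circle v → Bool) :
        (if Dominated ⟨v, y⟩ f then canonicalCocycle F o ⟨v, y⟩ else 0) =
        ∏ C, if y C = true → l C = true then
          (idempotentCoeff (circleWhiteOnRight o v hv C) (y C) : F) else 0 := by
      rw [Finset.prod_ite_zero]
      have hiff : Dominated ⟨v, y⟩ f ↔ ∀ C ∈ Finset.univ, y C = true → l C = true := by
        constructor
        · intro h C _
          induction C using Quotient.inductionOn with
          | h p => exact h p
        · exact fun h p => h ⟦p⟧ (Finset.mem_univ _)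
      by_cases h : Dominated ⟨v, y⟩ f
      · rw [if_pos h, if_pos (hiff.1 h)]
        unfold canonicalCocycle
        rw [dif_pos hv, finprod_eq_prod_of_fintype]
      · rw [if_neg h, if_neg (mt hiff.2 h)]
    rw [← Fintype.sum_of_injective (Sigma.mk v) sigma_mk_injective
      (fun y => ∏ C, if y C = true → l C = true then
          (idempotentCoeff (circleWhiteOnRight o v hv C) (y C) : F) else 0)]
    · have h1 := Finset.prod_univ_sum (fun _ : Circle v => (Finset.univ : Finset Bool))
        fun C b => if b = true → l C = true then
          (idempotentCoeff (circleWhiteOnRight o v hv C) b : F) else 0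
      rw [Fintype.piFinset_univ] at h1
      rw [← h1]
      simp only [sum_idempotentCoeff]
      rw [Finset.prod_ite_zero]
      by_cases h : f = whiteOnRight o
      · rw [if_pos (c := v = orientedState o ∧ f = whiteOnRight o) ⟨hv, h⟩, if_pos,
          Finset.prod_const_one]
        intro C _
        induction C using Quotient.inductionOn with
        | h p => exact (congrFun h p).symm
      · rw [if_neg (c := v = orientedState o ∧ f = whiteOnRight o) fun h' => h h'.2, if_neg]
        exact fun h' => h (funext fun p => (h' ⟦p⟧ (Finset.mem_univ _)).symm)
    · intro s hs
      rw [if_neg]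
      rintro ⟨rfl, -⟩
      exact hs ⟨s.2, rfl⟩
    · intro y
      rw [← hterm]
      exact if_congr (by simp) rfl rfl
  · rw [if_neg fun h => hv h.1]
    refine Finset.sum_eq_zero fun s _ => ?_
    split_ifs with h
    · unfold canonicalCocycle
      rw [dif_neg fun h' => hv (h.1.symm.trans h')]
    · rfl

theorem d_canonicalCocycle (o : D.Orientation) : d F (canonicalCocycle F o) = 0 := by
  classical
  refine eq_zero_of_evalAt F fun w f hf => ?_
  rw [evalAt_d F hf]
  refine Finset.sum_eq_zero fun c _ => ?_
  split_ifs with h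
  · rw [evalAt_canonicalCocycle F o h.2, if_neg, mul_zero]
    rintro ⟨-, rfl⟩
    exact whiteOnRight_bl_ne o c
      ((adjacent_update (v := w) (c := c) (b := false) (by simp [h.1])).apply_bl_eq hf h.2)
  · rfl

/-- At its own labelling the canonical cocycle has coordinate 1, whereas all coboundaries vanish
there. -/
theorem canonicalCocycle_ne_d (o : D.Orientation) (y : D.Cochain F) :
    canonicalCocycle F o ≠ d F y := by
  intro h
  have h1 := evalAt_canonicalCocycle F o (compat_whiteOnRight o)
  rw [h, evalAt_d_eq_zero F (compat_whiteOnRight o) (whiteOnRight_bl_ne o)] at h1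
  simp at h1

/-- Bar-Natan homology is spanned by the classes of the canonical cocycles. -/
theorem exists_eq_d_add_sum_canonicalCocycle {x : D.Cochain F} (hx : d F x = 0) :
    ∃ (y : D.Cochain F) (a : D.Orientation → F),
      x = d F y + ∑ o, a o • canonicalCocycle F o := by
  classical
  obtain ⟨y, hy⟩ := exists_evalAt_d_eq F hx
  refine ⟨y, fun o => evalAt F (orientedState o) (whiteOnRight o) x, ?_⟩
  rw [← sub_eq_zero]
  refine eq_zero_of_evalAt F fun w f hf => ?_
  rw [map_sub, map_add, map_sum]
  simp only [map_smul, evalAt_canonicalCocycle F _ hf, smul_eq_mul]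
  by_cases hex : ∃ c : D.Crossing, f (bl c) = f (tr c)
  · rw [hy w f hf hex, Finset.sum_eq_zero, add_zero, sub_self]
    intro o _
    rw [if_neg, mul_zero]
    rintro ⟨-, rfl⟩
    obtain ⟨c, hc⟩ := hex
    exact whiteOnRight_bl_ne o c hc
  · push Not at hex
    obtain ⟨o, rfl, rfl⟩ := exists_orientation hf hex
    rw [evalAt_d_eq_zero F hf hex, Finset.sum_eq_single o]
    · simp
    · intro o' _ hne
      rw [if_neg, mul_zero]
      exact fun h => hne (whiteOnRight_injective h.2).symm
    · exact fun h => absurd (Finset.mem_univ _) h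

end LinkDiagram

/-! ### Crossing signs, linking numbers and degrees -/

namespace LinkDiagram

variable {D : LinkDiagram}

section Degrees

theorem orientedState_eq (o : D.Orientation) (c : D.Crossing) :
    orientedState o c = !IsPositive o c := rfl

theorem weight_orientedState (o : D.Orientation) : weight (orientedState o) = nMinus o := by
  unfold weight nMinus
  congr 1
  ext c
  simp [orientedState_eq]

theorem nPlus_add_nMinus (o : D.Orientation) : nPlus o + nMinus o = Fintype.card D.Crossing := by
  unfold nPlus nMinus
  rw [← Finset.card_univ, ← Finset.card_filter_add_card_filter_not
    (s := (Finset.univ : Finset D.Crossing)) (fun c => IsPositive o c = true)]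
  simp

theorem nPlus_eq {o o' : D.Orientation} (h : nMinus o' = nMinus o) : nPlus o' = nPlus o := by
  have h1 := nPlus_add_nMinus o
  have h2 := nPlus_add_nMinus o'
  omega

/-- The `q`-degree sees the orientation only through its crossing counts, so all orientations with
the same `nMinus` share one filtered complex. -/
theorem qDegree_eq {o o' : D.Orientation} (h : nMinus o' = nMinus o) (s : D.EnhancedState) :
    qDegree o' s = qDegree o s := by
  unfold qDegree
  rw [h, nPlus_eq h]

/-- On each component, two orientations agree everywhere or nowhere. -/
theorem up_beq_eq_of_rel (o o' : D.Orientation) {p q : D.Point}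
    (h : D.curveSetoid (fun _ => CrossingMode.through) p q) :
    (o.up p == o.up q) = (o'.up p == o'.up q) := by
  have h1 : (o.up p == o'.up p) = (o.up q == o'.up q) := by
    induction h with
    | rel p q h =>
      have h1 := o.compat p q h
      have h2 := o'.compat p q h
      have h3 : o.up p = o.up q ↔ o'.up p = o'.up q := h1.trans h2.symm
      revert h3
      generalize o.up p = a, o.up q = b, o'.up p = a', o'.up q = b'
      revert a b a' b'
      decide
    | refl => rfl
    | symm _ _ _ ih => exact ih.symm
    | trans _ _ _ _ _ ih₁ ih₂ => exact ih₁.trans ih₂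
  revert h1
  generalize o.up p = a, o.up q = b, o'.up p = a', o'.up q = b'
  revert a b a' b'
  decide

theorem sum_sign (o : D.Orientation) :
    ∑ c : D.Crossing, (if IsPositive o c = true then 1 else -1 : ℚ) = nPlus o - nMinus o := by
  rw [Finset.sum_ite]
  simp [nPlus, nMinus, sub_eq_add_neg]

/-- Twice the total linking number is `n₊ - n₋` minus the signs of the self-crossings of components.
The latter do not depend on the orientation, and `n₊ + n₋` is the number of crossings. -/
theorem totalLinkingNumber_eq {o o' : D.Orientation} (h : nMinus o' = nMinus o) :
    totalLinkingNumber o' = totalLinkingNumber o := by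
  classical
  have hsplit (o : D.Orientation) : totalLinkingNumber o = ((nPlus o - nMinus o : ℚ) -
      ∑ c : D.Crossing, if (⟦bl c⟧ : D.Component) = ⟦br c⟧ then
        (if IsPositive o c = true then 1 else -1) else 0) / 2 := by
    unfold totalLinkingNumber
    rw [← sum_sign, ← Finset.sum_sub_distrib]
    congr 1
    refine Finset.sum_congr rfl fun c _ => ?_
    split_ifs <;> simp
  rw [hsplit, hsplit, h, nPlus_eq h]
  congr 2
  refine Finset.sum_congr rfl fun c _ => ?_
  by_cases hc : (⟦bl c⟧ : D.Component) = ⟦br c⟧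
  · have h1 : IsPositive o' c = IsPositive o c := by
      unfold IsPositive
      rw [up_beq_eq_of_rel o' o (Quotient.exact hc)]
    rw [h1]
  · rw [if_neg hc, if_neg hc]

theorem homDegree_of_dCoeff_ne_zero (o : D.Orientation) {s t : D.EnhancedState}
    (h : dCoeff s t ≠ 0) : homDegree o t = homDegree o s + 1 := by
  classical
  obtain ⟨c, -, hc⟩ := Finset.exists_ne_zero_of_sum_ne_zero h
  have h1 : s.1 c = false ∧ t.1 = Function.update s.1 c true := by
    by_contra h1
    exact hc (if_neg h1)
  have h2 : weight t.1 = weight s.1 + 1 := by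
    unfold weight
    rw [h1.2, ← Finset.card_insert_of_notMem (a := c) (by simp [h1.1])]
    congr 1
    ext b
    rcases eq_or_ne b c with rfl | hb
    · simp
    · simp [hb]
  unfold homDegree
  rw [h2]
  push_cast
  ring

end Degrees

/-! ### Homological grading and filtration level of canonical classes -/

variable (F : Type*) [Field F]

theorem d_apply (x : D.Cochain F) (t : D.EnhancedState) :
    d F x t = ∑ s, (dCoeff s t : F) * x s := rfl

/-- The projection to the cochains of homological degree `i`. -/
def homProj (o : D.Orientation) (i : ℤ) : D.Cochain F →ₗ[F] D.Cochain F where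
  toFun x s := if homDegree o s = i then x s else 0
  map_add' x y := by
    funext s
    simp only [Pi.add_apply]
    split_ifs <;> simp
  map_smul' a x := by
    funext s
    simp only [Pi.smul_apply, RingHom.id_apply]
    split_ifs <;> simp

theorem homProj_apply (o : D.Orientation) (i : ℤ) (x : D.Cochain F) (s : D.EnhancedState) :
    homProj F o i x s = if homDegree o s = i then x s else 0 := rfl

theorem d_homProj (o : D.Orientation) (i : ℤ) (x : D.Cochain F) :
    d F (homProj F o (i - 1) x) = homProj F o i (d F x) := by
  funext t
  rw [homProj_apply, d_apply, d_apply]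
  by_cases ht : homDegree o t = i
  · rw [if_pos ht]
    refine Finset.sum_congr rfl fun s _ => ?_
    by_cases h : dCoeff s t = 0
    · simp [h]
    · have h1 := homDegree_of_dCoeff_ne_zero o h
      rw [homProj_apply, if_pos (by omega)]
  · rw [if_neg ht]
    refine Finset.sum_eq_zero fun s _ => ?_
    by_cases h : dCoeff s t = 0
    · simp [h]
    · have h1 := homDegree_of_dCoeff_ne_zero o h
      rw [homProj_apply, if_neg (by omega), mul_zero]

theorem homProj_mem_homPart (o : D.Orientation) (i : ℤ) (x : D.Cochain F) :
    homProj F o i x ∈ homPart F o i := fun s hs => by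
  by_contra h
  exact hs (if_neg h)

theorem homProj_mem_filtration {o : D.Orientation} (i : ℤ) {j : ℤ} {x : D.Cochain F}
    (hx : x ∈ filtration F o j) : homProj F o i x ∈ filtration F o j := fun s hs =>
  hx s fun h => hs (by rw [homProj_apply, h, ite_self])

theorem homProj_eq_self {o : D.Orientation} {i : ℤ} {x : D.Cochain F} (hx : x ∈ homPart F o i) :
    homProj F o i x = x := by
  funext s
  rw [homProj_apply]
  split_ifs with h
  · rfl
  · by_contra h1
    exact h (hx s fun h2 => h1 h2.symm)

theorem homProj_eq_zero {o : D.Orientation} {i i' : ℤ} (hi : i ≠ i') {x : D.Cochain F}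
    (hx : x ∈ homPart F o i) : homProj F o i' x = 0 := by
  funext s
  rw [homProj_apply]
  split_ifs with h
  · by_contra h1
    exact hi ((hx s h1).symm.trans h)
  · rfl

/-- The oriented smoothing of `o'` has its `1`-smoothings at the negative crossings of `o'`; the
degree is measured with the grading of `o`. -/
theorem canonicalCocycle_mem_homPart (o o' : D.Orientation) :
    canonicalCocycle F o' ∈ homPart F o (nMinus o' - nMinus o) := by
  intro s hs
  have h : s.1 = orientedState o' := by
    by_contra h
    exact hs (dif_neg h)
  unfold homDegree
  rw [h, weight_orientedState]

theorem filtration_eq {o o' : D.Orientation} (h : nMinus o' = nMinus o) (j : ℤ) :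
    filtration F o' j = filtration F o j := by
  ext x
  exact forall₂_congr fun s _ => by rw [qDegree_eq h]

theorem filtration_antitone (o : D.Orientation) : Antitone (filtration F o) :=
  fun _ _ h _ hx s hs => h.trans (hx s hs)

theorem exists_qDegree_bounds (o : D.Orientation) :
    ∃ a b : ℤ, ∀ s : D.EnhancedState, a ≤ qDegree o s ∧ qDegree o s < b := by
  obtain ⟨a, ha⟩ := (Set.finite_range (qDegree o)).bddBelow
  obtain ⟨b, hb⟩ := (Set.finite_range (qDegree o)).bddAbove
  exact ⟨a, b + 1, fun s => ⟨ha ⟨s, rfl⟩, Int.lt_add_one_of_le (hb ⟨s, rfl⟩)⟩⟩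

theorem filtration_eq_top {o : D.Orientation} {a j : ℤ} (ha : ∀ s, a ≤ qDegree o s) (h : j ≤ a) :
    filtration F o j = ⊤ :=
  eq_top_iff.2 fun _ _ s _ => h.trans (ha s)

theorem filtration_eq_bot {o : D.Orientation} {b j : ℤ} (hb : ∀ s, qDegree o s < b) (h : b ≤ j) :
    filtration F o j = ⊥ :=
  eq_bot_iff.2 fun x hx => by
    refine (Submodule.mem_bot F).2 (funext fun s => ?_)
    by_contra hs
    exact absurd (hx s hs) (not_le.2 ((hb s).trans_le h))

/-- The canonical class of `o` lies in the `j`-th step of the filtration of homology. -/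
def CanonicalIn (o : D.Orientation) (j : ℤ) : Prop :=
  ∃ y : D.Cochain F, canonicalCocycle F o - d F y ∈ filtration F o j ∧ d F (d F y) = 0

/-- The second condition in `CanonicalIn` says that the modified representative is a cocycle, so `d
∘ d = 0` need not be invoked. -/
theorem mem_homologyFiltration_iff (o : D.Orientation) (j : ℤ) :
    Submodule.Quotient.mk (canonicalCocycle F o) ∈ homologyFiltration F o j ↔
      CanonicalIn F o j := by
  constructor
  · rintro ⟨z, ⟨hz, hzj⟩, he⟩
    obtain ⟨y, hy⟩ := (Submodule.Quotient.eq _).1 he.symm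
    refine ⟨y, ?_, ?_⟩
    · rwa [hy, sub_sub_cancel]
    · rw [hy, map_sub, d_canonicalCocycle, LinearMap.mem_ker.1 hz, sub_zero]
  · rintro ⟨y, hy, hdy⟩
    refine ⟨canonicalCocycle F o - d F y, ⟨?_, hy⟩, ?_⟩
    · rw [SetLike.mem_coe, LinearMap.mem_ker, map_sub, d_canonicalCocycle, hdy, sub_zero]
    · refine (Submodule.Quotient.eq _).2 ⟨-y, ?_⟩
      rw [map_neg]
      abel

variable {F} in
theorem CanonicalIn.mono {o : D.Orientation} {j j' : ℤ} (h : CanonicalIn F o j') (hj : j ≤ j') :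
    CanonicalIn F o j := by
  obtain ⟨y, hy, hdy⟩ := h
  exact ⟨y, filtration_antitone F o hj hy, hdy⟩

theorem exists_isGreatest_canonicalIn (o : D.Orientation) (n : ℤ) :
    ∃ m, IsGreatest {j : ℤ | j ≡ n [ZMOD 2] ∧ CanonicalIn F o j} m := by
  obtain ⟨a, b, hab⟩ := exists_qDegree_bounds o
  -- The witness `n - 2 * (|n| + |a|)` has the parity of `n` and is at most `a`, where the
  -- filtration is everything and `y = 0` works.
  refine (Int.exists_greatest_of_bdd (P := fun j => j ≡ n [ZMOD 2] ∧ CanonicalIn F o j)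
    ⟨b, ?_⟩ ⟨n - 2 * (|n| + |a|), ?_, 0, ?_, by simp⟩).imp fun m hm => ⟨hm.1, fun j hj => hm.2 j hj⟩
  · rintro j ⟨-, y, hy, -⟩
    by_contra hj
    rw [filtration_eq_bot F (fun s => (hab s).2) (not_le.1 hj).le, Submodule.mem_bot,
      sub_eq_zero] at hy
    exact canonicalCocycle_ne_d F o y hy
  · exact Int.modEq_iff_dvd.2 ⟨|n| + |a|, by ring⟩
  · rw [filtration_eq_top F (fun s => (hab s).1)]
    · trivial
    · have h1 := neg_abs_le a
      have h2 := le_abs_self n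
      have h3 := abs_nonneg n
      have h4 := abs_nonneg a
      linarith

/-! ### Independence of the field -/

section BaseChange

variable {F} {K : Type*} [Field K]

theorem map_intCast_mul (ρ : F →+ K) (n : ℤ) (a : F) : ρ (n * a) = n * ρ a := by
  rw [← zsmul_eq_mul, map_zsmul, zsmul_eq_mul]

theorem d_comp (ρ : F →+ K) (x : D.Cochain F) : d K (ρ ∘ x) = ρ ∘ d F x := by
  funext t
  simp only [d_apply, Function.comp_apply, map_sum, map_intCast_mul]

theorem comp_canonicalCocycle (ρ : F →+ K) (hρ : ρ 1 = 1) (o : D.Orientation) :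
    ρ ∘ canonicalCocycle F o = canonicalCocycle K o := by
  classical
  funext s
  have : Finite (Circle s.1) := Quotient.finite _
  let _ : Fintype (Circle s.1) := Fintype.ofFinite _
  simp only [Function.comp_apply, canonicalCocycle]
  split_ifs with h
  · rw [finprod_eq_prod_of_fintype, finprod_eq_prod_of_fintype, ← Int.cast_prod, ← Int.cast_prod]
    have h1 := map_intCast_mul ρ
      (∏ C, idempotentCoeff (circleWhiteOnRight o s.1 h C) (s.2 C)) 1
    rwa [hρ, mul_one, mul_one] at h1
  · exact map_zero ρ

/-- The differential and the canonical cocycle have integer entries, so they are respected by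
additive maps that preserve 1. Multiplicativity is not required, which admits linear retractions
onto a subfield. -/
theorem CanonicalIn.map {o : D.Orientation} {j : ℤ} (h : CanonicalIn F o j) (ρ : F →+ K)
    (hρ : ρ 1 = 1) : CanonicalIn K o j := by
  obtain ⟨y, hy, hdy⟩ := h
  refine ⟨ρ ∘ y, fun s hs => hy s fun h0 => hs ?_, ?_⟩
  · have h1 := congrArg ρ h0
    rw [Pi.sub_apply, map_sub, map_zero] at h1
    rw [Pi.sub_apply, ← comp_canonicalCocycle ρ hρ, d_comp]
    exact h1
  · rw [d_comp, d_comp, hdy]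
    funext s
    exact map_zero ρ

theorem canonicalIn_iff_of_algebra [Algebra K F] (o : D.Orientation) (j : ℤ) :
    CanonicalIn F o j ↔ CanonicalIn K o j := by
  constructor
  · intro h
    -- Descent uses a `K`-linear retraction of `K → F`.
    obtain ⟨ρ, hρ⟩ := LinearMap.exists_leftInverse_of_injective (Algebra.linearMap K F)
      (LinearMap.ker_eq_bot.2 (algebraMap K F).injective)
    refine h.map ρ.toAddMonoidHom ?_
    have h1 := LinearMap.congr_fun hρ 1
    simpa using h1
  · exact fun h => h.map (algebraMap K F).toAddMonoidHom (map_one (algebraMap K F))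

end BaseChange

/-- Every field of characteristic `p` is compared with its prime field, whose condition is `P`.
Hence an orientation can be chosen before the field is given. -/
theorem exists_canonicalIn_iff (D : LinkDiagram) (p : ℕ) (hp : p.Prime ∨ p = 0) :
    ∃ P : D.Orientation → ℤ → Prop,
      (∀ o n, ∃ m, IsGreatest {j : ℤ | j ≡ n [ZMOD 2] ∧ P o j} m) ∧
      ∀ (F : Type*) [Field F] [CharP F p] (o : D.Orientation) (j : ℤ),
        CanonicalIn F o j ↔ P o j := by
  rcases hp with hp | rfl
  · have : Fact p.Prime := ⟨hp⟩
    refine ⟨CanonicalIn (ZMod p), exists_isGreatest_canonicalIn (ZMod p), fun F _ _ => ?_⟩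
    let _ : Algebra (ZMod p) F := ZMod.algebra F p
    exact canonicalIn_iff_of_algebra
  · refine ⟨CanonicalIn ℚ, exists_isGreatest_canonicalIn ℚ, fun F _ _ => ?_⟩
    have : CharZero F := CharP.charP_to_charZero F
    exact canonicalIn_iff_of_algebra

/-! ### The limit page and the invariant `s_min` -/

section SpectralSequence

/-- The cocycles of homological degree `0` in the `j`-th step of the filtration. -/
noncomputable def filteredCocycles (o : D.Orientation) (j : ℤ) : Submodule F (D.Cochain F) :=
  homPart F o 0 ⊓ filtration F o j ⊓ LinearMap.ker (d F)

/-- The coboundaries of homological degree `0`. -/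
noncomputable def coboundaries (o : D.Orientation) : Submodule F (D.Cochain F) :=
  (homPart F o (0 - 1)).map (d F)

theorem filteredCocycles_antitone (o : D.Orientation) : Antitone (filteredCocycles F o) :=
  fun _ _ h => inf_le_inf_right _ (inf_le_inf_left _ (filtration_antitone F o h))

/-- For large `r`, the step `𝓕_{j+2r}` is zero and `𝓕_{j-2(r-1)}` is everything, so the page is the
quotient of the cocycles in `𝓕_j` by those in `𝓕_{j+2}` and the coboundaries in `𝓕_j`. This is the
associated graded of `H^0`. -/
theorem eInftyNeZero_iff (o : D.Orientation) (j : ℤ) : EInftyNeZero F o 0 j ↔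
    ¬ filteredCocycles F o j ≤ filteredCocycles F o (j + 2) ⊔ coboundaries F o := by
  obtain ⟨a, b, hab⟩ := exists_qDegree_bounds o
  have hcyc {r i : ℤ} (h : b ≤ i + 2 * r) : pageCycles F o r 0 i = filteredCocycles F o i := by
    unfold pageCycles filteredCocycles
    rw [filtration_eq_bot F (fun s => (hab s).2) h]
    rfl
  have key : ∀ᶠ r : ℤ in Filter.atTop, (Nontrivial (Page F o r 0 j) ↔
      ¬ filteredCocycles F o j ≤ filteredCocycles F o (j + 2) ⊔ coboundaries F o) := by
    filter_upwards [Filter.eventually_ge_atTop (|a| + |b| + |j| + 1)] with r hr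
    have ha := neg_abs_le a
    have ha' := abs_nonneg a
    have hb := le_abs_self b
    have hb' := abs_nonneg b
    have hj := neg_abs_le j
    have hj' := le_abs_self j
    rw [Submodule.Quotient.nontrivial_iff, Ne, Submodule.comap_subtype_eq_top]
    unfold pageBoundaries
    rw [hcyc (by linarith), hcyc (by linarith), not_iff_not]
    unfold pageCycles
    rw [filtration_eq_top F (fun s => (hab s).1) (by linarith), inf_top_eq, sub_add_cancel]
    refine ⟨fun h => h.trans (sup_le_sup_left (Submodule.map_mono inf_le_left) _),
      fun h z hz => ?_⟩
    obtain ⟨z', hz', _, ⟨y, hy, rfl⟩, rfl⟩ := Submodule.mem_sup.1 (h hz)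
    refine Submodule.add_mem_sup hz' ⟨y, ⟨hy, ?_⟩, rfl⟩
    -- The page boundaries demand `d y ∈ 𝓕_j`, which is automatic because `d y = z - z'`.
    have h1 := Submodule.sub_mem _ hz.1.2 (filtration_antitone F o (by omega : j ≤ j + 2) hz'.1.2)
    rwa [add_sub_cancel_left] at h1
  unfold EInftyNeZero
  rw [Filter.eventually_congr key, Filter.eventually_const]

/-- `CanonicalIn` allows an inhomogeneous `y`; projecting to homological degrees `-1` and `0` gives
the homogeneous form. -/
theorem canonicalCocycle_mem_iff {o o' : D.Orientation} (h : nMinus o' = nMinus o) (j : ℤ) :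
    canonicalCocycle F o' ∈ filteredCocycles F o j ⊔ coboundaries F o ↔ CanonicalIn F o' j := by
  have hdeg : canonicalCocycle F o' ∈ homPart F o 0 := by
    have h1 := canonicalCocycle_mem_homPart F o o'
    rwa [h, sub_self] at h1
  constructor
  · intro hc
    obtain ⟨z, hz, _, ⟨y, hy, rfl⟩, he⟩ := Submodule.mem_sup.1 hc
    refine ⟨y, ?_, ?_⟩
    · rw [filtration_eq F h, ← he, add_sub_cancel_right]
      exact hz.1.2
    · have h1 := congrArg (d F) he
      rwa [map_add, LinearMap.mem_ker.1 hz.2, zero_add, d_canonicalCocycle] at h1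
  · rintro ⟨y, hy, hdy⟩
    rw [filtration_eq F h] at hy
    have h1 := congrArg (homProj F o 0) (sub_add_cancel (canonicalCocycle F o') (d F y))
    rw [map_add, homProj_eq_self F hdeg, ← d_homProj] at h1
    rw [← h1]
    refine Submodule.add_mem_sup ⟨⟨homProj_mem_homPart F o 0 _, homProj_mem_filtration F 0 hy⟩, ?_⟩
      ⟨_, homProj_mem_homPart F o _ y, rfl⟩
    have h2 := d_homProj F o 1 (canonicalCocycle F o' - d F y)
    rw [map_sub (d F), d_canonicalCocycle, hdy, sub_zero, map_zero] at h2
    exact h2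

/-- The degree 0 part of homology is spanned by the canonical classes with the same `nMinus`; if all
of these reach level `j`, every class does. -/
theorem filteredCocycles_le {o : D.Orientation} {j : ℤ}
    (h : ∀ o' : D.Orientation, nMinus o' = nMinus o → CanonicalIn F o' j) (i : ℤ) :
    filteredCocycles F o i ≤ filteredCocycles F o j ⊔ coboundaries F o := by
  intro z hz
  obtain ⟨y, a, hya⟩ := exists_eq_d_add_sum_canonicalCocycle F (LinearMap.mem_ker.1 hz.2)
  have h1 := congrArg (homProj F o 0) hya
  rw [homProj_eq_self F hz.1.1, map_add, ← d_homProj, map_sum] at h1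
  rw [h1]
  refine Submodule.add_mem _ (Submodule.mem_sup_right ⟨_, homProj_mem_homPart F o _ y, rfl⟩)
    (Submodule.sum_mem _ fun o' _ => ?_)
  rw [map_smul]
  refine Submodule.smul_mem _ _ ?_
  have h2 := canonicalCocycle_mem_homPart F o o'
  by_cases h3 : nMinus o' = nMinus o
  · rw [h3, sub_self] at h2
    rw [homProj_eq_self F h2]
    exact (canonicalCocycle_mem_iff F h3 j).2 (h o' h3)
  · rw [homProj_eq_zero F (by omega) h2]
    exact Submodule.zero_mem _

/-- Below `j` the graded pieces vanish because all of `H^0` comes from `𝓕_j`. At `j` the piece is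
nonzero, since otherwise the class of `o'` would come from `𝓕_{j+2}`. -/
theorem isSMin_of_canonicalIn {o o' : D.Orientation} {j : ℤ} (hj : j ≡ D.numComponents [ZMOD 2])
    (ho' : nMinus o' = nMinus o)
    (h : ∀ o'' : D.Orientation, nMinus o'' = nMinus o → CanonicalIn F o'' j)
    (hne : ¬ CanonicalIn F o' (j + 2)) : IsSMin F o (j + 1) := by
  unfold IsSMin
  rw [add_sub_cancel_right]
  refine ⟨⟨hj, ?_⟩, ?_⟩
  · rw [eInftyNeZero_iff]
    intro hle
    refine hne ((canonicalCocycle_mem_iff F ho' (j + 2)).1 ?_)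
    exact sup_le hle le_sup_right ((canonicalCocycle_mem_iff F ho' j).2 (h o' ho'))
  · rintro i ⟨hi, hi'⟩
    by_contra hlt
    rw [eInftyNeZero_iff] at hi'
    have h1 : i ≡ j [ZMOD 2] := hi.trans hj.symm
    have h2 : i + 2 ≤ j := by
      unfold Int.ModEq at h1
      omega
    exact hi' ((filteredCocycles_le F h i).trans
      (sup_le_sup_right (filteredCocycles_antitone F o h2) _))

end SpectralSequence

end LinkDiagram

/-! ### The theorem -/

theorem proposition1p1 (D : LinkDiagram) (o : D.Orientation) (p : ℕ) (hp : p.Prime ∨ p = 0) :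
    ∃ o' : D.Orientation,
      (∃ t : ℤ, ∀ (F : Type*) [Field F] [CharP F p],
        LinkDiagram.IsSInvariant F o' t ∧ LinkDiagram.IsSMin F o t) ∧
      LinkDiagram.totalLinkingNumber o' = LinkDiagram.totalLinkingNumber o := by
  obtain ⟨P, hP, hPF⟩ := LinkDiagram.exists_canonicalIn_iff D p hp
  choose m hm using fun o => hP o D.numComponents
  -- Among the finitely many orientations whose canonical class lies in degree 0, take one with the
  -- lowest filtration level `m`.
  obtain ⟨o', ho', hmin⟩ := Set.exists_min_image
    {o' : D.Orientation | LinkDiagram.nMinus o' = LinkDiagram.nMinus o} m (Set.toFinite _) ⟨o, rfl⟩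
  refine ⟨o', ⟨m o' + 1, fun F _ _ => ⟨?_, ?_⟩⟩, LinkDiagram.totalLinkingNumber_eq ho'⟩
  · unfold LinkDiagram.IsSInvariant
    have hF := hPF F
    simp only [LinkDiagram.mem_homologyFiltration_iff, hF, add_sub_cancel_right]
    exact hm o'
  · refine LinkDiagram.isSMin_of_canonicalIn F (hm o').1.1 ho' (fun o'' ho'' => ?_) fun h => ?_
    · exact ((hPF F o'' _).2 (hm o'').1.2).mono (hmin o'' ho'')
    · have h1 := (hm o').2 ⟨?_, (hPF F o' _).1 h⟩
      · omega
      · have h2 := (hm o').1.1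
        unfold Int.ModEq at h2 ⊢
        omega
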